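/- All vector spaces are real. For a finite-dimensional vector space $V$ put $\lambda(V)=\Lambda^{\dim V}V$ and let $\lambda^*(V)$ be the dual line of $\lambda(V)$; an isomorphism $\varphi$ of finite-dimensional vector spaces induces an isomorphism $\lambda(\varphi)$ of top exterior powers. If $v$ is a nonzero element of a line $L$, let $v^*\in L^*$ be the functional with $v^*(v)=1$. A short exact sequence $0\to V'\xrightarrow{i}V\xrightarrow{j}V''\to0$ of finite-dimensional vector spaces determines an isomorphism $\lambda(V')\otimes\lambda(V'')\to\lambda(V)$, $a\otimes b\mapsto a\wedge_V b$, with $$(v_1'\wedge\dots\wedge v_k')\wedge_V\big(j(v_1)\wedge\dots\wedge j(v_\ell)\big)=i(v_1')\wedge\dots\wedge i(v_k')\wedge v_1\wedge\dots\wedge v_\ell .$$ **Determinant lines.** A bounded operator $D:X\to Y$ between Banach spaces is Fredholm if its range is closed and $\kappa(D)=\ker D$ and $\mathfrak c(D)=Y/\operatorname{Im}D$ are finite-dimensional; $\operatorname{ind}D=\dim\kappa(D)-\dim\mathfrak c(D)$. Its determinant line is $\lambda(D)=\lambda(\kappa(D))\otimes\lambda^*(\mathfrak c(D))$. For Fredholm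 operators $D_1,D_2$ let $$R:\lambda(D_1)\otimes\lambda(D_2)\to\lambda(D_2)\otimes\lambda(D_1),\qquad v_1\otimes v_2\mapsto(-1)^{(\operatorname{ind}D_1)(\operatorname{ind}D_2)}\,v_2\otimes v_1 .$$ For a Banach space $Z$ the isomorphisms $\kappa(D)\to\kappa(D\oplus\mathrm{id}_Z)$, $x\mapsto(x,0)$, and $\mathfrak c(D)\to\mathfrak c(D\oplus\mathrm{id}_Z)$, $[y]\mapsto[(y,0)]$, identify $\lambda(D\oplus\mathrm{id}_Z)$ with $\lambda(D)$. **Exact triples.** An exact triple $\mathfrak t$ of Fredholm operators is a commutative diagram with exact rows $0\to X'\xrightarrow{\mathfrak i_X}X\xrightarrow{\mathfrak j_X}X''\to0$ and $0\to Y'\xrightarrow{\mathfrak i_Y}Y\xrightarrow{\mathfrak j_Y}Y''\to0$ of Banach spaces and bounded operators, and with Fredholm operators $D':X'\to Y'$, $D:X\to Y$, $D'':X''\to Y''$ as columns. Let $$0\to\kappa(D')\xrightarrow{\mathfrak i_X}\kappa(D)\xrightarrow{\mathfrak j_X}\kappa(D'')\xrightarrow{\delta}\mathfrak c(D')\xrightarrow{\mathfrak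 i_Y}\mathfrak c(D)\xrightarrow{\mathfrak j_Y}\mathfrak c(D'')\to0$$ be the exact sequence of the Snake Lemma, where $\delta(\mathfrak j_Xx)=[y']$ if $Dx=\mathfrak i_Yy'$, and let $$\epsilon_{\mathfrak t}=(\operatorname{ind}D'')\dim\mathfrak c(D')+\dim\mathfrak c(D)\,\dim\operatorname{Im}\delta .$$ The isomorphism $\Psi_{\mathfrak t}:\lambda(D')\otimes\lambda(D'')\to\lambda(D)$ is the one with $$\Psi_{\mathfrak t}\big(x\otimes(v\wedge_{\mathfrak c(D')}w)^*\otimes(u\wedge_{\kappa(D'')}v)\otimes y^*\big)=(-1)^{\epsilon_{\mathfrak t}}\,(x\wedge_{\kappa(D)}u)\otimes(w\wedge_{\mathfrak c(D)}y)^*$$ for all nonzero $x\in\lambda(\kappa(D'))$, $u\in\lambda(\operatorname{Im}(\mathfrak j_X|_{\kappa(D)}))$, $v\in\lambda(\operatorname{Im}\delta)$, $w\in\lambda(\operatorname{Im}(\mathfrak i_Y:\mathfrak c(D')\to\mathfrak c(D)))$, $y\in\lambda(\mathfrak c(D''))$. Here $\wedge$ is taken with respect to the four short exact sequences into which the sequence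 above decomposes: $0\to\kappa(D')\to\kappa(D)\to\operatorname{Im}\mathfrak j_X\to0$, $0\to\operatorname{Im}\mathfrak j_X\to\kappa(D'')\to\operatorname{Im}\delta\to0$, $0\to\operatorname{Im}\delta\to\mathfrak c(D')\to\operatorname{Im}\mathfrak i_Y\to0$ and $0\to\operatorname{Im}\mathfrak i_Y\to\mathfrak c(D)\to\mathfrak c(D'')\to0$. **Compositions.** For Fredholm operators $D_1:X_1\to X_2$ and $D_2:X_2\to X_3$ let $\iota_{\mathcal C}(D_1,D_2)$ be the exact triple with rows $$0\to X_1\to X_1\oplus X_2\to X_2\to0,\qquad 0\to X_2\to X_3\oplus X_2\to X_3\to0,$$ with maps $\mathfrak i_X(x_1)=(x_1,D_1x_1)$, $\mathfrak j_X(x_1,x_2)=D_1x_1-x_2$, $\mathfrak i_Y(x_2)=(D_2x_2,x_2)$, $\mathfrak j_Y(x_3,x_2)=x_3-D_2x_2$, and with columns $D_1$, $(D_2\circ D_1)\oplus\mathrm{id}_{X_2}$, $D_2$. With the identification of $\lambda((D_2\circ D_1)\oplus\mathrm{id}_{X_2})$ with $\lambda(D_2\circ D_1)$, put $$\widetilde{\mathcal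 C}_{D_1,D_2}=\Psi_{\iota_{\mathcal C}(D_1,D_2)}:\lambda(D_1)\otimes\lambda(D_2)\to\lambda(D_2\circ D_1).$$ **Proposition.** Let $0\to X_k'\xrightarrow{\mathfrak i_k}X_k\xrightarrow{\mathfrak j_k}X_k''\to0$, $k=1,2,3$, be short exact sequences of Banach spaces and bounded operators. Let $\mathfrak t_1$ be an exact triple of Fredholm operators with columns $D_1',D_1,D_1''$ from the first of these rows to the second, and let $\mathfrak t_2$ be an exact triple of Fredholm operators with columns $D_2',D_2,D_2''$ from the second row to the third. Let $\mathcal C_{\mathcal T}(\mathfrak t_1,\mathfrak t_2)$ be the exact triple from the first row to the third with columns $D_2'\circ D_1'$, $D_2\circ D_1$, $D_2''\circ D_1''$. Then $$\widetilde{\mathcal C}_{D_1,D_2}\circ\big(\Psi_{\mathfrak t_1}\otimes\Psi_{\mathfrak t_2}\big)=\Psi_{\mathcal C_{\mathcal T}(\mathfrak t_1,\mathfrak t_2)}\circ\big(\widetilde{\mathcal C}_{D_1',D_2'}\otimes\widetilde{\mathcal C}_{D_1'',D_2''}\big)\circ(\mathrm{id}\otimes R\otimes\mathrm{id})$$ as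 isomorphisms $\lambda(D_1')\otimes\lambda(D_1'')\otimes\lambda(D_2')\otimes\lambda(D_2'')\to\lambda(D_2\circ D_1)$, where $R:\lambda(D_1'')\otimes\lambda(D_2')\to\lambda(D_2')\otimes\lambda(D_1'')$. -/

import Mathlib

open scoped TensorProduct
open Module

namespace FredholmDet

noncomputable section

/-! ### Top exterior powers and short exact sequences -/

section Lines

variable {V V' V'' W : Type*} [AddCommGroup V] [Module ℝ V] [AddCommGroup V'] [Module ℝ V']
  [AddCommGroup V''] [Module ℝ V''] [AddCommGroup W] [Module ℝ W]

/-- The top exterior power `λ(V)` of a finite-dimensional real vector space `V`. -/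
abbrev TopExt (V : Type*) [AddCommGroup V] [Module ℝ V] : Type _ := ⋀[ℝ]^(finrank ℝ V) V

theorem finrank_topExt (V : Type*) [AddCommGroup V] [Module ℝ V] [FiniteDimensional ℝ V] :
    finrank ℝ (TopExt V) = 1 := by
  rw [exteriorPower.finrank_eq, Nat.choose_self]

theorem exists_topExt_ne_zero (V : Type*) [AddCommGroup V] [Module ℝ V] [FiniteDimensional ℝ V] :
    ∃ v : TopExt V, v ≠ 0 := by
  have : Nontrivial (TopExt V) := Module.nontrivial_of_finrank_pos (R := ℝ)
    (by rw [finrank_topExt]; exact one_pos)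
  exact exists_ne 0

theorem map_mem_exteriorPower (f : V →ₗ[ℝ] W) {n : ℕ} {x : ExteriorAlgebra ℝ V}
    (hx : x ∈ ⋀[ℝ]^n V) : ExteriorAlgebra.map f x ∈ ⋀[ℝ]^n W := by
  rw [show ExteriorAlgebra.map f x = (exteriorPower.map n f ⟨x, hx⟩ : ExteriorAlgebra ℝ W) from ?_]
  · exact (exteriorPower.map n f ⟨x, hx⟩).2
  · have h : (ExteriorAlgebra.map f).toLinearMap ∘ₗ (⋀[ℝ]^n V).subtype =
        (⋀[ℝ]^n W).subtype ∘ₗ exteriorPower.map n f := by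
      ext m
      simp [ExteriorAlgebra.map_apply_ιMulti]
    exact LinearMap.congr_fun h ⟨x, hx⟩

theorem mul_mem_exteriorPower {m n k : ℕ} (hk : m + n = k) {x y : ExteriorAlgebra ℝ V}
    (hx : x ∈ ⋀[ℝ]^m V) (hy : y ∈ ⋀[ℝ]^n V) : x * y ∈ ⋀[ℝ]^k V := by
  subst hk
  change x * y ∈ LinearMap.range (ExteriorAlgebra.ι ℝ) ^ (m + n)
  rw [pow_add]
  exact Submodule.mul_mem_mul hx hy

/-- The isomorphism `λ(φ) : λ(V) → λ(W)` induced by an isomorphism `φ : V → W`. -/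
def topMap (φ : V ≃ₗ[ℝ] W) : TopExt V ≃ₗ[ℝ] TopExt W :=
  LinearEquiv.ofLinearMap
    ((ExteriorAlgebra.map (φ : V →ₗ[ℝ] W)).toLinearMap.restrict fun _ hx =>
      φ.finrank_eq ▸ map_mem_exteriorPower _ hx)
    ((ExteriorAlgebra.map (φ.symm : W →ₗ[ℝ] V)).toLinearMap.restrict fun _ hx =>
      φ.symm.finrank_eq ▸ map_mem_exteriorPower _ hx)
    (by
      ext x
      simp [Function.comp_def])
    (by
      ext x
      simp [Function.comp_def])

/-- The element `b₁ ∧ … ∧ bₙ` of `λ(V)` given by a basis `b` of `V`. -/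
def topVec {n : ℕ} (b : Basis (Fin n) ℝ V) : TopExt V :=
  ⟨ExteriorAlgebra.ιMulti ℝ n b, by
    rw [finrank_eq_card_basis b, Fintype.card_fin]
    exact ExteriorAlgebra.ιMulti_range ℝ n (Set.mem_range_self _)⟩

theorem topVec_ne_zero {n : ℕ} (b : Basis (Fin n) ℝ V) : topVec b ≠ 0 := by
  intro h
  have h0 : exteriorPower.ιMulti ℝ n b = 0 :=
    Subtype.ext (congrArg (fun x : TopExt V => (x : ExteriorAlgebra ℝ V)) h)
  have h1 := exteriorPower.alternatingMapLinearEquiv_apply_ιMulti (b.det) b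
  rw [h0, map_zero, b.det_self] at h1
  exact zero_ne_one h1

/-- For a nonzero element `v` of `λ(V)`, the functional `v^*` on `λ(V)` with `v^*(v) = 1`
(and `0` if `v = 0`). -/
def dualVec [FiniteDimensional ℝ V] (v : TopExt V) : Dual ℝ (TopExt V) :=
  open Classical in
  if hv : v ≠ 0 then (FiniteDimensional.basisSingleton Unit (finrank_topExt V) v hv).coord () else 0

theorem dualVec_self [FiniteDimensional ℝ V] {v : TopExt V} (hv : v ≠ 0) : dualVec v v = 1 := by
  have h := (FiniteDimensional.basisSingleton Unit (finrank_topExt V) v hv).repr_self ()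
  rw [FiniteDimensional.basisSingleton_apply] at h
  simp [dualVec, hv, h]

theorem exists_smul_eq_topExt [FiniteDimensional ℝ V] {v : TopExt V} (hv : v ≠ 0) (w : TopExt V) :
    ∃ c : ℝ, w = c • v := by
  obtain ⟨c, hc⟩ := exists_smul_eq_of_finrank_eq_one (finrank_topExt V) hv w
  exact ⟨c, hc.symm⟩

theorem dualVec_smul [FiniteDimensional ℝ V] {c : ℝ} (hc : c ≠ 0) {v : TopExt V} (hv : v ≠ 0) :
    dualVec (c • v) = c⁻¹ • dualVec v := by
  apply LinearMap.ext
  intro w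
  obtain ⟨d, rfl⟩ := exists_smul_eq_topExt hv w
  have h1 := dualVec_self (smul_ne_zero hc hv)
  rw [map_smul, smul_eq_mul] at h1
  have h2 : dualVec (c • v) v = c⁻¹ := eq_inv_of_mul_eq_one_right h1
  simp [h2, dualVec_self hv]

theorem dualVec_ne_zero [FiniteDimensional ℝ V] {v : TopExt V} (hv : v ≠ 0) : dualVec v ≠ 0 := by
  intro h
  have h1 := dualVec_self hv
  rw [h, LinearMap.zero_apply] at h1
  exact zero_ne_one h1

theorem tmul_ne_zero {L M : Type*} [AddCommGroup L] [Module ℝ L] [AddCommGroup M] [Module ℝ M]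
    {x : L} {y : M} (hx : x ≠ 0) (hy : y ≠ 0) : x ⊗ₜ[ℝ] y ≠ 0 := by
  intro h
  obtain ⟨f, hf⟩ := not_forall.1 (mt (Module.forall_dual_apply_eq_zero_iff ℝ x).1 hx)
  obtain ⟨g, hg⟩ := not_forall.1 (mt (Module.forall_dual_apply_eq_zero_iff ℝ y).1 hy)
  have h1 := congrArg ((TensorProduct.lid ℝ ℝ).toLinearMap ∘ₗ TensorProduct.map f g) h
  simp only [LinearMap.comp_apply, LinearEquiv.coe_coe, TensorProduct.map_tmul,
    TensorProduct.lid_tmul, map_zero, smul_eq_mul] at h1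
  exact mul_ne_zero hf hg h1

/-- The isomorphism between two lines that takes the nonzero vector `e` to the nonzero
vector `f`. -/
def lineEquiv {L M : Type*} [AddCommGroup L] [Module ℝ L] [AddCommGroup M] [Module ℝ M]
    (hL : finrank ℝ L = 1) (hM : finrank ℝ M = 1) (e : L) (he : e ≠ 0) (f : M) (hf : f ≠ 0) :
    L ≃ₗ[ℝ] M :=
  (FiniteDimensional.basisSingleton Unit hL e he).equiv (FiniteDimensional.basisSingleton Unit hM f hf) (Equiv.refl Unit)

theorem lineEquiv_apply {L M : Type*} [AddCommGroup L] [Module ℝ L] [AddCommGroup M] [Module ℝ M]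
    (hL : finrank ℝ L = 1) (hM : finrank ℝ M = 1) (e : L) (he : e ≠ 0) (f : M) (hf : f ≠ 0) :
    lineEquiv hL hM e he f hf e = f := by
  have h := (FiniteDimensional.basisSingleton Unit hL e he).equiv_apply () (FiniteDimensional.basisSingleton Unit hM f hf)
    (Equiv.refl Unit)
  rw [FiniteDimensional.basisSingleton_apply, Equiv.refl_apply,
    FiniteDimensional.basisSingleton_apply] at h
  exact h

theorem finrank_eq_add_of_exact [FiniteDimensional ℝ V] {i : V' →ₗ[ℝ] V} {j : V →ₗ[ℝ] V''}
    (hi : Function.Injective i) (hij : Function.Exact i j) (hj : Function.Surjective j) :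
    finrank ℝ V' + finrank ℝ V'' = finrank ℝ V := by
  rw [← LinearMap.finrank_range_add_finrank_ker j, LinearMap.range_eq_top.2 hj, finrank_top,
    hij.linearMap_ker_eq, LinearMap.finrank_range_of_inj hi, add_comm]

/-- A linear right inverse of a surjective linear map. -/
def sectionOf {j : V →ₗ[ℝ] V''} (hj : Function.Surjective j) : V'' →ₗ[ℝ] V :=
  (j.exists_rightInverse_of_surjective (LinearMap.range_eq_top.2 hj)).choose

theorem sectionOf_apply {j : V →ₗ[ℝ] V''} (hj : Function.Surjective j) (x : V'') :
    j (sectionOf hj x) = x :=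
  LinearMap.congr_fun
    (j.exists_rightInverse_of_surjective (LinearMap.range_eq_top.2 hj)).choose_spec x

/-- The pairing `∧_V : λ(V') × λ(V'') → λ(V)` of a short exact sequence
`0 → V' → V → V'' → 0`, namely
`(v'₁ ∧ … ∧ v'ₖ, j v₁ ∧ … ∧ j vₗ) ↦ i v'₁ ∧ … ∧ i v'ₖ ∧ v₁ ∧ … ∧ vₗ`.
It does not depend on the way the elements of `V''` are lifted to `V`, see `wedge_topVec`. -/
def wedge [FiniteDimensional ℝ V] (i : V' →ₗ[ℝ] V) (j : V →ₗ[ℝ] V'')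
    (hi : Function.Injective i) (hij : Function.Exact i j) (hj : Function.Surjective j) :
    TopExt V' →ₗ[ℝ] TopExt V'' →ₗ[ℝ] TopExt V :=
  LinearMap.mk₂ ℝ
    (fun a b => ⟨ExteriorAlgebra.map i a * ExteriorAlgebra.map (sectionOf hj) b,
      mul_mem_exteriorPower (finrank_eq_add_of_exact hi hij hj)
        (map_mem_exteriorPower i a.2) (map_mem_exteriorPower _ b.2)⟩)
    (fun a a' b => Subtype.ext (by simp [add_mul]))
    (fun c a b => Subtype.ext (by simp))
    (fun a b b' => Subtype.ext (by simp [mul_add]))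
    (fun c a b => Subtype.ext (by simp))

/-- If `a` is annihilated by all vectors in `ker j`, then `a ∧ v₁ ∧ … ∧ vₙ` depends only on `a`
and on `j v₁, …, j vₙ`. -/
theorem mul_ιMulti_eq (j : V →ₗ[ℝ] V'') {n : ℕ} (a : ExteriorAlgebra ℝ V)
    (ha : ∀ x, j x = 0 → a * ExteriorAlgebra.ι ℝ x = 0) (v w : Fin n → V)
    (h : ∀ k, j (v k) = j (w k)) :
    a * ExteriorAlgebra.ιMulti ℝ n v = a * ExteriorAlgebra.ιMulti ℝ n w := by
  induction n generalizing a with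
  | zero => simp
  | succ n ih =>
    rw [ExteriorAlgebra.ιMulti_succ_apply, ExteriorAlgebra.ιMulti_succ_apply, ← mul_assoc,
      ← mul_assoc]
    have h0 : a * ExteriorAlgebra.ι ℝ (v 0) = a * ExteriorAlgebra.ι ℝ (w 0) := by
      rw [← sub_eq_zero, ← mul_sub, ← map_sub]
      exact ha _ (by rw [map_sub, h 0, sub_self])
    rw [h0]
    refine ih _ (fun x hx => ?_) _ _ (fun k => h _)
    have hs := ExteriorAlgebra.ι_add_mul_swap (R := ℝ) (w 0) x
    rw [mul_assoc, eq_neg_of_add_eq_zero_left hs, mul_neg, ← mul_assoc, ha x hx, zero_mul, neg_zero]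

/-- The formula that determines `∧_V`. -/
theorem wedge_topVec [FiniteDimensional ℝ V] (i : V' →ₗ[ℝ] V) (j : V →ₗ[ℝ] V'')
    (hi : Function.Injective i) (hij : Function.Exact i j) (hj : Function.Surjective j)
    {k l : ℕ} (b' : Basis (Fin k) ℝ V') (b'' : Basis (Fin l) ℝ V'') (v : Fin l → V)
    (hv : ∀ p, j (v p) = b'' p) :
    (wedge i j hi hij hj (topVec b') (topVec b'') : ExteriorAlgebra ℝ V) =
      ExteriorAlgebra.ιMulti ℝ k (fun p => i (b' p)) * ExteriorAlgebra.ιMulti ℝ l v := by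
  change ExteriorAlgebra.map i (ExteriorAlgebra.ιMulti ℝ k b') *
    ExteriorAlgebra.map (sectionOf hj) (ExteriorAlgebra.ιMulti ℝ l b'') = _
  rw [ExteriorAlgebra.map_apply_ιMulti, ExteriorAlgebra.map_apply_ιMulti]
  refine mul_ιMulti_eq j _ (fun x hx => ?_) _ _ (fun p => ?_)
  · obtain ⟨x', rfl⟩ := (hij x).1 hx
    have h1 : ExteriorAlgebra.ιMulti ℝ k b' * ExteriorAlgebra.ι ℝ x' = 0 := by
      have hle : ExteriorAlgebra.ιMulti ℝ k b' * ExteriorAlgebra.ι ℝ x' ∈ ⋀[ℝ]^(k + 1) V' := by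
        refine mul_mem_exteriorPower rfl (ExteriorAlgebra.ιMulti_range ℝ k (Set.mem_range_self _)) ?_
        change _ ∈ LinearMap.range (ExteriorAlgebra.ι ℝ) ^ 1
        rw [pow_one]
        exact LinearMap.mem_range_self _ _
      have : FiniteDimensional ℝ V' := b'.finiteDimensional_of_finite
      have h0 : finrank ℝ (⋀[ℝ]^(k + 1) V') = 0 := by
        rw [exteriorPower.finrank_eq, finrank_eq_card_basis b', Fintype.card_fin,
          Nat.choose_succ_self]
      have hsub : Subsingleton (⋀[ℝ]^(k + 1) V') := finrank_zero_iff.1 h0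
      exact congrArg Subtype.val (Subsingleton.elim (⟨_, hle⟩ : ⋀[ℝ]^(k + 1) V') 0)
    have h2 := congrArg (ExteriorAlgebra.map i) h1
    rwa [map_mul, ExteriorAlgebra.map_apply_ιMulti, ExteriorAlgebra.map_apply_ι, map_zero] at h2
  · simp [sectionOf_apply, hv]

theorem wedge_ne_zero [FiniteDimensional ℝ V] [FiniteDimensional ℝ V'] [FiniteDimensional ℝ V'']
    (i : V' →ₗ[ℝ] V) (j : V →ₗ[ℝ] V'')
    (hi : Function.Injective i) (hij : Function.Exact i j) (hj : Function.Surjective j)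
    {a : TopExt V'} {b : TopExt V''} (ha : a ≠ 0) (hb : b ≠ 0) :
    wedge i j hi hij hj a b ≠ 0 := by
  have key : wedge i j hi hij hj (topVec (finBasis ℝ V')) (topVec (finBasis ℝ V'')) ≠ 0 := by
    let T : (V' × V'') →ₗ[ℝ] V := i.coprod (sectionOf hj)
    have hT : Function.Bijective T := by
      constructor
      · rw [← LinearMap.ker_eq_bot, LinearMap.ker_eq_bot']
        rintro ⟨x, y⟩ h
        have h1 : i x + sectionOf hj y = 0 := h
        have h2 := congrArg j h1
        rw [map_add, hij.apply_apply_eq_zero, sectionOf_apply, zero_add, map_zero] at h2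
        rw [h2, map_zero, add_zero] at h1
        rw [h2, hi (h1.trans (map_zero i).symm)]
        rfl
      · intro x
        obtain ⟨y, hy⟩ := (hij (x - sectionOf hj (j x))).1 (by
          rw [map_sub, sectionOf_apply, sub_self])
        exact ⟨(y, j x), by simp [T, hy]⟩
    let B := (((finBasis ℝ V').prod (finBasis ℝ V'')).map
      (LinearEquiv.ofBijective T hT)).reindex finSumFinEquiv
    have hB : wedge i j hi hij hj (topVec (finBasis ℝ V')) (topVec (finBasis ℝ V'')) =
        topVec B := by
      apply Subtype.ext
      rw [wedge_topVec i j hi hij hj _ _ (fun p => sectionOf hj (finBasis ℝ V'' p))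
        (fun p => sectionOf_apply hj _)]
      change _ = ExteriorAlgebra.ιMulti ℝ _ B
      have hB' : (B : _ → V) = Fin.append (fun p => i (finBasis ℝ V' p))
          (fun p => sectionOf hj (finBasis ℝ V'' p)) := by
        funext p
        refine Fin.addCases (fun p => ?_) (fun p => ?_) p <;> simp [B, T]
      rw [hB', ExteriorAlgebra.ιMulti_apply, ExteriorAlgebra.ιMulti_apply,
        ExteriorAlgebra.ιMulti_apply, ← List.prod_append, ← List.ofFn_fin_append]
      congr 2
      funext p
      refine Fin.addCases (fun p => ?_) (fun p => ?_) p <;> simp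
    rw [hB]
    exact topVec_ne_zero B
  obtain ⟨c, rfl⟩ := exists_smul_eq_topExt (topVec_ne_zero (finBasis ℝ V')) a
  obtain ⟨d, rfl⟩ := exists_smul_eq_topExt (topVec_ne_zero (finBasis ℝ V'')) b
  rw [map_smul, map_smul, LinearMap.smul_apply]
  exact smul_ne_zero (fun h => hb (by rw [h, zero_smul]))
    (smul_ne_zero (fun h => ha (by rw [h, zero_smul])) key)

end Lines

/-! ### Fredholm operators and determinant lines -/

section Fredholm

/-- The set `𝓕(X, Y)` of Fredholm operators between the Banach spaces `X` and `Y`. -/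
structure FredholmOp (X Y : Type*) [NormedAddCommGroup X] [NormedSpace ℝ X]
    [NormedAddCommGroup Y] [NormedSpace ℝ Y] where
  /-- The underlying bounded operator. -/
  toCLM : X →L[ℝ] Y
  isFredholm : toCLM.IsFredholm

variable {X Y Z : Type*} [NormedAddCommGroup X] [NormedSpace ℝ X]
  [NormedAddCommGroup Y] [NormedSpace ℝ Y] [NormedAddCommGroup Z] [NormedSpace ℝ Z]

/-- In the setting of Banach spaces, an operator is Fredholm if and only if its range is closed
and its kernel and cokernel are finite-dimensional. -/
theorem isFredholm_iff [CompleteSpace X] [CompleteSpace Y] (D : X →L[ℝ] Y) :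
    D.IsFredholm ↔ IsClosed (Set.range D) ∧ FiniteDimensional ℝ (LinearMap.ker D.toLinearMap) ∧
      FiniteDimensional ℝ (Y ⧸ LinearMap.range D.toLinearMap) := by
  refine ⟨fun h => ⟨h.isClosed_range, h.finite_ker, h.finite_coker⟩, fun ⟨h₁, h₂, h₃⟩ => ?_⟩
  refine ⟨?_, h₁, h₂, h₃, Submodule.ClosedComplemented.of_finiteDimensional _⟩
  have hcl : IsClosed (LinearMap.range D.toLinearMap : Set Y) := h₁
  have : CompleteSpace (LinearMap.range D.toLinearMap) := hcl.completeSpace_coe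
  have hopen : IsOpenMap (D.codRestrict (LinearMap.range D.toLinearMap)
      (fun x => LinearMap.mem_range_self D.toLinearMap x)) := by
    refine ContinuousLinearMap.isOpenMap _ ?_
    rintro ⟨_, x, rfl⟩
    exact ⟨x, rfl⟩
  exact (Topology.IsEmbedding.subtypeVal.isStrictMap_iff).1
    (hopen.isStrictMap (ContinuousLinearMap.continuous _))

namespace FredholmOp

/-- The kernel `κ(D)`. -/
abbrev ker (D : FredholmOp X Y) : Submodule ℝ X := LinearMap.ker D.toCLM.toLinearMap

/-- The image `Im D`. -/
abbrev range (D : FredholmOp X Y) : Submodule ℝ Y := LinearMap.range D.toCLM.toLinearMap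

/-- The cokernel `𝔠(D) = Y / Im D`. -/
abbrev coker (D : FredholmOp X Y) : Type _ := Y ⧸ D.range

instance (D : FredholmOp X Y) : FiniteDimensional ℝ D.ker := D.isFredholm.finite_ker

instance (D : FredholmOp X Y) : FiniteDimensional ℝ D.coker := D.isFredholm.finite_coker

/-- The Fredholm index. -/
def ind (D : FredholmOp X Y) : ℤ := (finrank ℝ D.ker : ℤ) - (finrank ℝ D.coker : ℤ)

/-- The composition `D₂ ∘ D₁` of Fredholm operators. -/
def comp (D₂ : FredholmOp Y Z) (D₁ : FredholmOp X Y) : FredholmOp X Z where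
  toCLM := D₂.toCLM ∘L D₁.toCLM
  isFredholm := by
    obtain ⟨v₁, h₁⟩ := D₁.isFredholm.exists_isQuasiInverse
    obtain ⟨v₂, h₂⟩ := D₂.isFredholm.exists_isQuasiInverse
    exact .of_isQuasiInverse (v := v₁ ∘L v₂) (h₁.comp h₂)

open scoped LinearMap.FiniteRangeSetoid in
theorem prodMap_id_equiv_id {u : X →L[ℝ] Y} {v : Y →L[ℝ] X}
    (h : u.toLinearMap ∘ₗ v.toLinearMap ≈ LinearMap.id) :
    (u.prodMap (ContinuousLinearMap.id ℝ Z)).toLinearMap ∘ₗ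
      (v.prodMap (ContinuousLinearMap.id ℝ Z)).toLinearMap ≈ LinearMap.id := by
  rw [LinearMap.FiniteRangeSetoid.equiv_iff_hasNoetherianRange] at h ⊢
  have h' := (h.comp_right (LinearMap.fst ℝ Y Z)).comp_left (LinearMap.inl ℝ Y Z)
  have e : (u.prodMap (ContinuousLinearMap.id ℝ Z)).toLinearMap ∘ₗ
      (v.prodMap (ContinuousLinearMap.id ℝ Z)).toLinearMap - LinearMap.id =
      LinearMap.inl ℝ Y Z ∘ₗ (u.toLinearMap ∘ₗ v.toLinearMap - LinearMap.id) ∘ₗ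
        LinearMap.fst ℝ Y Z := by
    apply LinearMap.ext
    rintro ⟨y, z⟩
    exact Prod.ext rfl (sub_self z)
  rw [e]
  exact h'

/-- The direct sum `D ⊕ id_Z`. -/
def stab (D : FredholmOp X Y) (Z : Type*) [NormedAddCommGroup Z] [NormedSpace ℝ Z] :
    FredholmOp (X × Z) (Y × Z) where
  toCLM := D.toCLM.prodMap (ContinuousLinearMap.id ℝ Z)
  isFredholm := by
    obtain ⟨v, h⟩ := D.isFredholm.exists_isQuasiInverse
    exact .of_isQuasiInverse (v := v.prodMap (ContinuousLinearMap.id ℝ Z))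
      ⟨prodMap_id_equiv_id h.1, prodMap_id_equiv_id h.2⟩

end FredholmOp

/-- The determinant line `λ(D) = λ(κ(D)) ⊗ λ(𝔠(D))^*`. -/
def DetLine (D : FredholmOp X Y) : Type _ :=
  TopExt D.ker ⊗[ℝ] Dual ℝ (TopExt D.coker)

instance (D : FredholmOp X Y) : AddCommGroup (DetLine D) :=
  inferInstanceAs (AddCommGroup (TopExt D.ker ⊗[ℝ] Dual ℝ (TopExt D.coker)))

instance (D : FredholmOp X Y) : Module ℝ (DetLine D) :=
  inferInstanceAs (Module ℝ (TopExt D.ker ⊗[ℝ] Dual ℝ (TopExt D.coker)))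

/-- The bilinear map `(x, α) ↦ x ⊗ α` into `λ(D)`. -/
def DetLine.mk (D : FredholmOp X Y) :
    TopExt D.ker →ₗ[ℝ] Dual ℝ (TopExt D.coker) →ₗ[ℝ] DetLine D :=
  TensorProduct.mk ℝ (TopExt D.ker) (Dual ℝ (TopExt D.coker))

theorem finrank_detLine (D : FredholmOp X Y) : finrank ℝ (DetLine D) = 1 := by
  change finrank ℝ (TopExt D.ker ⊗[ℝ] Dual ℝ (TopExt D.coker)) = 1
  rw [finrank_tensorProduct, Subspace.dual_finrank_eq, finrank_topExt, finrank_topExt]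

/-- The isomorphism `κ(D) → κ(D ⊕ id_Z)`, `x ↦ (x, 0)`. -/
def stabKer (D : FredholmOp X Y) (Z : Type*) [NormedAddCommGroup Z] [NormedSpace ℝ Z] :
    D.ker ≃ₗ[ℝ] (D.stab Z).ker :=
  LinearEquiv.ofLinearMap
    ((LinearMap.inl ℝ X Z).restrict (p := D.ker) (q := (D.stab Z).ker) fun x hx =>
      Prod.ext hx rfl)
    ((LinearMap.fst ℝ X Z).restrict (p := (D.stab Z).ker) (q := D.ker) fun _ hx =>
      congrArg Prod.fst hx)
    (by
      ext ⟨⟨x, z⟩, h⟩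
      · rfl
      · exact (congrArg Prod.snd h).symm)
    (by
      ext x
      rfl)

/-- The isomorphism `𝔠(D) → 𝔠(D ⊕ id_Z)`, `y + Im D ↦ (y, 0) + Im (D ⊕ id_Z)`. -/
def stabCoker (D : FredholmOp X Y) (Z : Type*) [NormedAddCommGroup Z] [NormedSpace ℝ Z] :
    D.coker ≃ₗ[ℝ] (D.stab Z).coker :=
  LinearEquiv.ofLinearMap
    (D.range.mapQ (D.stab Z).range (LinearMap.inl ℝ Y Z) (by
      rintro _ ⟨x, rfl⟩
      exact ⟨(x, 0), rfl⟩))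
    ((D.stab Z).range.mapQ D.range (LinearMap.fst ℝ Y Z) (by
      rintro _ ⟨x, rfl⟩
      exact ⟨x.1, rfl⟩))
    (by
      apply LinearMap.ext
      intro q
      obtain ⟨⟨y, z⟩, rfl⟩ := Submodule.Quotient.mk_surjective _ q
      exact (Submodule.Quotient.eq _).2 ⟨(0, -z), by
        change (D.toCLM 0, -z) = (y, (0 : Z)) - (y, z)
        simp⟩)
    (by
      apply LinearMap.ext
      intro q
      obtain ⟨y, rfl⟩ := Submodule.Quotient.mk_surjective _ q
      rfl)

/-- The canonical identification `λ(D) = λ(D ⊕ id_Z)`,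
`x₁ ∧ … ∧ xₖ ⊗ (y₁ ∧ … ∧ yₗ)^* ↦ (x₁, 0) ∧ … ∧ (xₖ, 0) ⊗ ((y₁, 0) ∧ … ∧ (yₗ, 0))^*`. -/
def stabIso (D : FredholmOp X Y) (Z : Type*) [NormedAddCommGroup Z] [NormedSpace ℝ Z] :
    DetLine D ≃ₗ[ℝ] DetLine (D.stab Z) :=
  TensorProduct.congr (topMap (stabKer D Z)) (topMap (stabCoker D Z)).symm.dualMap

/-- The sign `(-1)^n`. -/
def sgn (n : ℤ) : ℝˣ := (-1 : ℝˣ) ^ n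

/-- The graded interchange `R : λ(D₁) ⊗ λ(D₂) → λ(D₂) ⊗ λ(D₁)`,
`v₁ ⊗ v₂ ↦ (-1)^(deg λ(D₁) deg λ(D₂)) v₂ ⊗ v₁`, where `deg λ(D) = ind D` modulo `2`. -/
def gradedSwap {X₁ Y₁ X₂ Y₂ : Type*} [NormedAddCommGroup X₁] [NormedSpace ℝ X₁]
    [NormedAddCommGroup Y₁] [NormedSpace ℝ Y₁] [NormedAddCommGroup X₂] [NormedSpace ℝ X₂]
    [NormedAddCommGroup Y₂] [NormedSpace ℝ Y₂] (D₁ : FredholmOp X₁ Y₁) (D₂ : FredholmOp X₂ Y₂) :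
    DetLine D₁ ⊗[ℝ] DetLine D₂ ≃ₗ[ℝ] DetLine D₂ ⊗[ℝ] DetLine D₁ :=
  TensorProduct.comm ℝ (DetLine D₁) (DetLine D₂) ≪≫ₗ
    LinearEquiv.smulOfUnit (sgn (D₁.ind * D₂.ind))

/-- The map `id ⊗ f ⊗ id : A ⊗ B ⊗ C ⊗ E → A ⊗ C ⊗ B ⊗ E` induced by `f : B ⊗ C → C ⊗ B`. -/
def middleMap {A B C E : Type*} [AddCommGroup A] [Module ℝ A] [AddCommGroup B] [Module ℝ B]
    [AddCommGroup C] [Module ℝ C] [AddCommGroup E] [Module ℝ E]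
    (f : B ⊗[ℝ] C ≃ₗ[ℝ] C ⊗[ℝ] B) :
    (A ⊗[ℝ] B) ⊗[ℝ] (C ⊗[ℝ] E) ≃ₗ[ℝ] (A ⊗[ℝ] C) ⊗[ℝ] (B ⊗[ℝ] E) :=
  TensorProduct.assoc ℝ A B (C ⊗[ℝ] E) ≪≫ₗ
    TensorProduct.congr (LinearEquiv.refl ℝ A)
      ((TensorProduct.assoc ℝ B C E).symm ≪≫ₗ
        TensorProduct.congr f (LinearEquiv.refl ℝ E) ≪≫ₗ
        TensorProduct.assoc ℝ C B E) ≪≫ₗ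
    (TensorProduct.assoc ℝ A C (B ⊗[ℝ] E)).symm

end Fredholm

/-! ### Exact triples of Fredholm operators -/

section Triples

/-- A short exact sequence `0 → X' → X → X'' → 0` of Banach spaces. -/
structure BanachSES (X' X X'' : Type*) [NormedAddCommGroup X'] [NormedSpace ℝ X']
    [NormedAddCommGroup X] [NormedSpace ℝ X] [NormedAddCommGroup X''] [NormedSpace ℝ X''] where
  i : X' →L[ℝ] X
  j : X →L[ℝ] X''
  injective : Function.Injective i
  exact : Function.Exact i j
  surjective : Function.Surjective j

variable {X' X X'' Y' Y Y'' Z' Z Z'' : Type*}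
  [NormedAddCommGroup X'] [NormedSpace ℝ X'] [NormedAddCommGroup X] [NormedSpace ℝ X]
  [NormedAddCommGroup X''] [NormedSpace ℝ X''] [NormedAddCommGroup Y'] [NormedSpace ℝ Y']
  [NormedAddCommGroup Y] [NormedSpace ℝ Y] [NormedAddCommGroup Y''] [NormedSpace ℝ Y'']
  [NormedAddCommGroup Z'] [NormedSpace ℝ Z'] [NormedAddCommGroup Z] [NormedSpace ℝ Z]
  [NormedAddCommGroup Z''] [NormedSpace ℝ Z'']

/-- An exact triple of Fredholm operators with top row `r` and bottom row `s`, i.e. Fredholm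
operators `D', D, D''` that form a commutative diagram with the rows
`0 → X' → X → X'' → 0` and `0 → Y' → Y → Y'' → 0`. -/
structure ExactTriple (r : BanachSES X' X X'') (s : BanachSES Y' Y Y'') where
  left : FredholmOp X' Y'
  mid : FredholmOp X Y
  right : FredholmOp X'' Y''
  comm_i : ∀ x, mid.toCLM (r.i x) = s.i (left.toCLM x)
  comm_j : ∀ x, right.toCLM (r.j x) = s.j (mid.toCLM x)

namespace ExactTriple

variable {r : BanachSES X' X X''} {s : BanachSES Y' Y Y''} {q : BanachSES Z' Z Z''}

/-- The composition `𝒞_𝒯(𝔱₁, 𝔱₂)`, with operators `D₂' ∘ D₁'`, `D₂ ∘ D₁`, `D₂'' ∘ D₁''`. -/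
abbrev comp (t₁ : ExactTriple r s) (t₂ : ExactTriple s q) : ExactTriple r q where
  left := t₂.left.comp t₁.left
  mid := t₂.mid.comp t₁.mid
  right := t₂.right.comp t₁.right
  comm_i x := by
    change t₂.mid.toCLM (t₁.mid.toCLM (r.i x)) = q.i (t₂.left.toCLM (t₁.left.toCLM x))
    rw [t₁.comm_i, t₂.comm_i]
  comm_j x := by
    change t₂.right.toCLM (t₁.right.toCLM (r.j x)) = q.j (t₂.mid.toCLM (t₁.mid.toCLM x))
    rw [t₁.comm_j, t₂.comm_j]

variable (t : ExactTriple r s)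

/-- `𝔦_X : κ(D') → κ(D)`. -/
def kerI : t.left.ker →ₗ[ℝ] t.mid.ker :=
  r.i.toLinearMap.restrict fun x (hx : t.left.toCLM x = 0) => by
    change t.mid.toCLM (r.i x) = 0
    rw [t.comm_i, hx, map_zero]

/-- `𝔧_X : κ(D) → κ(D'')`. -/
def kerJ : t.mid.ker →ₗ[ℝ] t.right.ker :=
  r.j.toLinearMap.restrict fun x (hx : t.mid.toCLM x = 0) => by
    change t.right.toCLM (r.j x) = 0
    rw [t.comm_j, hx, map_zero]

/-- `𝔦_Y : 𝔠(D') → 𝔠(D)`. -/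
def cokerI : t.left.coker →ₗ[ℝ] t.mid.coker :=
  t.left.range.mapQ t.mid.range s.i.toLinearMap (by
    rintro _ ⟨x, rfl⟩
    exact ⟨r.i x, t.comm_i x⟩)

/-- `𝔧_Y : 𝔠(D) → 𝔠(D'')`. -/
def cokerJ : t.mid.coker →ₗ[ℝ] t.right.coker :=
  t.mid.range.mapQ t.right.range s.j.toLinearMap (by
    rintro _ ⟨x, rfl⟩
    exact ⟨r.j x, t.comm_j x⟩)

theorem exact_mkQ {A B : Type*} [AddCommGroup A] [Module ℝ A] [AddCommGroup B] [Module ℝ B]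
    (f : A →ₗ[ℝ] B) : Function.Exact f (LinearMap.range f).mkQ := by
  rw [LinearMap.exact_iff, Submodule.ker_mkQ]

theorem exact_subtype {A B : Type*} [AddCommGroup A] [Module ℝ A] [AddCommGroup B] [Module ℝ B]
    (f : A →ₗ[ℝ] B) : Function.Exact (LinearMap.ker f).subtype f := by
  rw [LinearMap.exact_iff, Submodule.range_subtype]

theorem linearMap_comm_i : s.i.toLinearMap ∘ₗ t.left.toCLM.toLinearMap =
    t.mid.toCLM.toLinearMap ∘ₗ r.i.toLinearMap :=
  LinearMap.ext fun x => (t.comm_i x).symm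

theorem linearMap_comm_j : s.j.toLinearMap ∘ₗ t.mid.toCLM.toLinearMap =
    t.right.toCLM.toLinearMap ∘ₗ r.j.toLinearMap :=
  LinearMap.ext fun x => (t.comm_j x).symm

/-- The connecting homomorphism `δ : κ(D'') → 𝔠(D')` of the snake lemma. -/
def delta : t.right.ker →ₗ[ℝ] t.left.coker :=
  SnakeLemma.δ' t.left.toCLM.toLinearMap t.mid.toCLM.toLinearMap t.right.toCLM.toLinearMap
    r.i.toLinearMap r.j.toLinearMap r.exact s.i.toLinearMap s.j.toLinearMap s.exact
    t.linearMap_comm_i t.linearMap_comm_j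
    t.right.ker.subtype (exact_subtype _) t.left.range.mkQ (exact_mkQ _)
    r.surjective s.injective

/-- `δ x'' = y' + Im D'` whenever `x'' = 𝔧_X x` and `D x = 𝔦_Y y'`. -/
theorem delta_eq (x'' : t.right.ker) (x : X) (hx : r.j x = x'') (y' : Y')
    (hy : s.i y' = t.mid.toCLM x) : t.delta x'' = t.left.range.mkQ y' :=
  SnakeLemma.δ'_eq _ _ _ _ _ _ _ _ _ _ _ _ _ _ _ _ _ x'' x hx y' hy

theorem kerI_injective : Function.Injective t.kerI := fun _ _ h =>
  Subtype.ext (r.injective (congrArg Subtype.val h))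

theorem exact_kerI_kerJ : Function.Exact t.kerI t.kerJ := by
  intro x
  constructor
  · intro h
    obtain ⟨x', hx'⟩ := (r.exact x).1 (congrArg Subtype.val h)
    refine ⟨⟨x', ?_⟩, Subtype.ext hx'⟩
    change t.left.toCLM x' = 0
    apply s.injective
    rw [← t.comm_i, hx', map_zero]
    exact x.2
  · rintro ⟨x', rfl⟩
    exact Subtype.ext (r.exact.apply_apply_eq_zero _)

theorem exact_kerJ_delta : Function.Exact t.kerJ t.delta :=
  SnakeLemma.exact_δ'_right _ _ _ _ _ _ _ _ _ _ _ t.mid.ker.subtype (exact_subtype _) _ _ _ _ _ _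
    t.kerJ rfl Subtype.val_injective

theorem exact_delta_cokerI : Function.Exact t.delta t.cokerI :=
  SnakeLemma.exact_δ'_left _ _ _ _ _ _ _ _ _ _ _ _ _ _ _ t.mid.range.mkQ (exact_mkQ _) _ _
    t.cokerI rfl (Submodule.mkQ_surjective _)

theorem exact_cokerI_cokerJ : Function.Exact t.cokerI t.cokerJ := by
  intro c
  obtain ⟨y, rfl⟩ := Submodule.mkQ_surjective _ c
  constructor
  · intro h
    obtain ⟨x'', hx''⟩ := (Submodule.Quotient.mk_eq_zero t.right.range).1 h
    obtain ⟨x, rfl⟩ := r.surjective x''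
    obtain ⟨y', hy'⟩ := (s.exact (y - t.mid.toCLM x)).1 (by
      rw [map_sub, ← t.comm_j, sub_eq_zero]
      exact hx''.symm)
    refine ⟨t.left.range.mkQ y', (Submodule.Quotient.eq _).2 ⟨-x, ?_⟩⟩
    change t.mid.toCLM (-x) = s.i y' - y
    rw [hy', map_neg]
    abel
  · rintro ⟨c', hc'⟩
    obtain ⟨y', rfl⟩ := Submodule.mkQ_surjective _ c'
    rw [← hc']
    change t.right.range.mkQ (s.j (s.i y')) = 0
    rw [s.exact.apply_apply_eq_zero, map_zero]

theorem cokerJ_surjective : Function.Surjective t.cokerJ := by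
  intro c
  obtain ⟨y'', rfl⟩ := Submodule.mkQ_surjective _ c
  obtain ⟨y, rfl⟩ := s.surjective y''
  exact ⟨t.mid.range.mkQ y, rfl⟩

theorem exact_rangeRestrict {A B C : Type*} [AddCommGroup A] [Module ℝ A] [AddCommGroup B]
    [Module ℝ B] [AddCommGroup C] [Module ℝ C] {f : A →ₗ[ℝ] B} {g : B →ₗ[ℝ] C}
    (h : Function.Exact f g) : Function.Exact f g.rangeRestrict := fun x =>
  Iff.trans ⟨fun hx => congrArg Subtype.val hx, fun hx => Subtype.ext hx⟩ (h x)

theorem exact_range_subtype {A B C : Type*} [AddCommGroup A] [Module ℝ A] [AddCommGroup B]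
    [Module ℝ B] [AddCommGroup C] [Module ℝ C] {f : A →ₗ[ℝ] B} {g : B →ₗ[ℝ] C}
    (h : Function.Exact f g) : Function.Exact (LinearMap.range f).subtype g := fun x =>
  Iff.trans (h x) ⟨fun hx => ⟨⟨x, hx⟩, rfl⟩, fun ⟨y, hy⟩ => hy ▸ y.2⟩

/-- `∧_{κ(D)} : λ(κ(D')) × λ(Im 𝔧_X) → λ(κ(D))`. -/
def wedgeKer : TopExt t.left.ker →ₗ[ℝ] TopExt (LinearMap.range t.kerJ) →ₗ[ℝ] TopExt t.mid.ker :=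
  wedge t.kerI t.kerJ.rangeRestrict t.kerI_injective (exact_rangeRestrict t.exact_kerI_kerJ)
    t.kerJ.surjective_rangeRestrict

/-- `∧_{κ(D'')} : λ(Im 𝔧_X) × λ(Im δ) → λ(κ(D''))`. -/
def wedgeKerRight : TopExt (LinearMap.range t.kerJ) →ₗ[ℝ] TopExt (LinearMap.range t.delta) →ₗ[ℝ]
    TopExt t.right.ker :=
  wedge (LinearMap.range t.kerJ).subtype t.delta.rangeRestrict Subtype.val_injective
    (exact_range_subtype (exact_rangeRestrict t.exact_kerJ_delta))
    t.delta.surjective_rangeRestrict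

/-- `∧_{𝔠(D')} : λ(Im δ) × λ(Im 𝔦_Y) → λ(𝔠(D'))`. -/
def wedgeCokerLeft : TopExt (LinearMap.range t.delta) →ₗ[ℝ] TopExt (LinearMap.range t.cokerI) →ₗ[ℝ]
    TopExt t.left.coker :=
  wedge (LinearMap.range t.delta).subtype t.cokerI.rangeRestrict Subtype.val_injective
    (exact_range_subtype (exact_rangeRestrict t.exact_delta_cokerI))
    t.cokerI.surjective_rangeRestrict

/-- `∧_{𝔠(D)} : λ(Im 𝔦_Y) × λ(𝔠(D'')) → λ(𝔠(D))`. -/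
def wedgeCoker : TopExt (LinearMap.range t.cokerI) →ₗ[ℝ] TopExt t.right.coker →ₗ[ℝ]
    TopExt t.mid.coker :=
  wedge (LinearMap.range t.cokerI).subtype t.cokerJ Subtype.val_injective
    (exact_range_subtype t.exact_cokerI_cokerJ) t.cokerJ_surjective

/-- The exponent `ε_𝔱 = (ind D'') dim 𝔠(D') + dim 𝔠(D) dim (Im δ)`. -/
def eps : ℤ :=
  t.right.ind * finrank ℝ t.left.coker + finrank ℝ t.mid.coker * finrank ℝ (LinearMap.range t.delta)

/-- The vector `x ⊗ (v ∧ w)^* ⊗ (u ∧ v) ⊗ y^*` of `λ(D') ⊗ λ(D'')`. -/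
def source (x : TopExt t.left.ker) (u : TopExt (LinearMap.range t.kerJ))
    (v : TopExt (LinearMap.range t.delta)) (w : TopExt (LinearMap.range t.cokerI))
    (y : TopExt t.right.coker) : DetLine t.left ⊗[ℝ] DetLine t.right :=
  DetLine.mk t.left x (dualVec (t.wedgeCokerLeft v w)) ⊗ₜ[ℝ]
    DetLine.mk t.right (t.wedgeKerRight u v) (dualVec y)

/-- The vector `(-1)^ε_𝔱 (x ∧ u) ⊗ (w ∧ y)^*` of `λ(D)`. -/
def target (x : TopExt t.left.ker) (u : TopExt (LinearMap.range t.kerJ))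
    (w : TopExt (LinearMap.range t.cokerI)) (y : TopExt t.right.coker) : DetLine t.mid :=
  sgn t.eps • DetLine.mk t.mid (t.wedgeKer x u) (dualVec (t.wedgeCoker w y))

theorem source_ne_zero {x : TopExt t.left.ker} {u : TopExt (LinearMap.range t.kerJ)}
    {v : TopExt (LinearMap.range t.delta)} {w : TopExt (LinearMap.range t.cokerI)}
    {y : TopExt t.right.coker} (hx : x ≠ 0) (hu : u ≠ 0) (hv : v ≠ 0) (hw : w ≠ 0) (hy : y ≠ 0) :
    t.source x u v w y ≠ 0 :=
  tmul_ne_zero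
    (tmul_ne_zero hx (dualVec_ne_zero (wedge_ne_zero _ _ _ _ _ hv hw)))
    (tmul_ne_zero (wedge_ne_zero _ _ _ _ _ hu hv) (dualVec_ne_zero hy))

theorem target_ne_zero {x : TopExt t.left.ker} {u : TopExt (LinearMap.range t.kerJ)}
    {w : TopExt (LinearMap.range t.cokerI)}
    {y : TopExt t.right.coker} (hx : x ≠ 0) (hu : u ≠ 0) (hw : w ≠ 0) (hy : y ≠ 0) :
    t.target x u w y ≠ 0 := by
  have h : DetLine.mk t.mid (t.wedgeKer x u) (dualVec (t.wedgeCoker w y)) ≠ 0 :=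
    tmul_ne_zero (wedge_ne_zero _ _ _ _ _ hx hu) (dualVec_ne_zero (wedge_ne_zero _ _ _ _ _ hw hy))
  exact smul_ne_zero (sgn t.eps).ne_zero h

/-- A choice of a nonzero element of `λ(V)`. -/
def gen (V : Type*) [AddCommGroup V] [Module ℝ V] [FiniteDimensional ℝ V] : TopExt V :=
  (exists_topExt_ne_zero V).choose

theorem gen_ne_zero (V : Type*) [AddCommGroup V] [Module ℝ V] [FiniteDimensional ℝ V] :
    gen V ≠ 0 := (exists_topExt_ne_zero V).choose_spec

/-- The isomorphism `Ψ_𝔱 : λ(D') ⊗ λ(D'') → λ(D)` with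
`Ψ_𝔱 (x ⊗ (v ∧ w)^* ⊗ (u ∧ v) ⊗ y^*) = (-1)^ε_𝔱 (x ∧ u) ⊗ (w ∧ y)^*`
for all nonzero `x ∈ λ(κ(D'))`, `u ∈ λ(Im 𝔧_X)`, `v ∈ λ(Im δ)`, `w ∈ λ(Im 𝔦_Y)` and
`y ∈ λ(𝔠(D''))`. It is defined through one choice of `x, u, v, w, y`; by `psi_source` the formula
holds for all of them. -/
def psi : DetLine t.left ⊗[ℝ] DetLine t.right ≃ₗ[ℝ] DetLine t.mid :=
  lineEquiv (by rw [finrank_tensorProduct, finrank_detLine, finrank_detLine]) (finrank_detLine _)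
    (t.source (gen _) (gen _) (gen _) (gen _) (gen _))
    (t.source_ne_zero (gen_ne_zero _) (gen_ne_zero _) (gen_ne_zero _) (gen_ne_zero _)
      (gen_ne_zero _))
    (t.target (gen _) (gen _) (gen _) (gen _))
    (t.target_ne_zero (gen_ne_zero _) (gen_ne_zero _) (gen_ne_zero _) (gen_ne_zero _))

theorem psi_source {x : TopExt t.left.ker} {u : TopExt (LinearMap.range t.kerJ)}
    {v : TopExt (LinearMap.range t.delta)} {w : TopExt (LinearMap.range t.cokerI)}
    {y : TopExt t.right.coker} (hx : x ≠ 0) (hu : u ≠ 0) (hv : v ≠ 0) (hw : w ≠ 0) (hy : y ≠ 0) :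
    t.psi (t.source x u v w y) = t.target x u w y := by
  have key : t.psi (t.source (gen _) (gen _) (gen _) (gen _) (gen _)) =
      t.target (gen _) (gen _) (gen _) (gen _) := lineEquiv_apply ..
  obtain ⟨a, rfl⟩ := exists_smul_eq_topExt (gen_ne_zero _) x
  obtain ⟨b, rfl⟩ := exists_smul_eq_topExt (gen_ne_zero _) u
  obtain ⟨c, rfl⟩ := exists_smul_eq_topExt (gen_ne_zero _) v
  obtain ⟨d, rfl⟩ := exists_smul_eq_topExt (gen_ne_zero _) w
  obtain ⟨e, rfl⟩ := exists_smul_eq_topExt (gen_ne_zero _) y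
  have hc : c ≠ 0 := (smul_ne_zero_iff.1 hv).1
  have hd : d ≠ 0 := (smul_ne_zero_iff.1 hw).1
  have he : e ≠ 0 := (smul_ne_zero_iff.1 hy).1
  have h1 : t.wedgeCokerLeft (gen _) (gen _) ≠ 0 :=
    wedge_ne_zero _ _ _ _ _ (gen_ne_zero _) (gen_ne_zero _)
  have h2 : t.wedgeCoker (gen _) (gen _) ≠ 0 :=
    wedge_ne_zero _ _ _ _ _ (gen_ne_zero _) (gen_ne_zero _)
  have hs : t.source (a • gen _) (b • gen _) (c • gen _) (d • gen _) (e • gen _) =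
      (a * b * d⁻¹ * e⁻¹) • t.source (gen _) (gen _) (gen _) (gen _) (gen _) := by
    simp only [source, map_smul, LinearMap.smul_apply, dualVec_smul (mul_ne_zero hd hc) h1,
      dualVec_smul he (gen_ne_zero _),
      TensorProduct.smul_tmul', TensorProduct.tmul_smul, smul_smul]
    congr 1
    field_simp
  have ht : t.target (a • gen _) (b • gen _) (d • gen _) (e • gen _) =
      (a * b * d⁻¹ * e⁻¹) • t.target (gen _) (gen _) (gen _) (gen _) := by
    simp only [target, map_smul, LinearMap.smul_apply, dualVec_smul (mul_ne_zero he hd) h2,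
      smul_smul, smul_comm (sgn t.eps)]
    congr 1
    field_simp
  rw [hs, ht, map_smul, key]

end ExactTriple

/-- The short exact sequence `0 → X → X × Y → Y → 0` with maps `x ↦ (x, D x)` and
`(x, y) ↦ D x - y`. -/
def graphSES (D : X →L[ℝ] Y) : BanachSES X (X × Y) Y where
  i := (ContinuousLinearMap.id ℝ X).prod D
  j := D ∘L ContinuousLinearMap.fst ℝ X Y - ContinuousLinearMap.snd ℝ X Y
  injective _ _ h := congrArg Prod.fst h
  exact := by
    rintro ⟨x, y⟩
    constructor
    · intro h
      exact ⟨x, Prod.ext rfl (sub_eq_zero.1 h)⟩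
    · rintro ⟨z, hz⟩
      rw [← hz]
      exact sub_self (D z)
  surjective y := ⟨(0, -y), by simp⟩

/-- The short exact sequence `0 → Y → Z × Y → Z → 0` with maps `y ↦ (D y, y)` and
`(z, y) ↦ z - D y`. -/
def cographSES (D : Y →L[ℝ] Z) : BanachSES Y (Z × Y) Z where
  i := D.prod (ContinuousLinearMap.id ℝ Y)
  j := ContinuousLinearMap.fst ℝ Z Y - D ∘L ContinuousLinearMap.snd ℝ Z Y
  injective _ _ h := congrArg Prod.snd h
  exact := by
    rintro ⟨z, y⟩
    constructor
    · intro h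
      exact ⟨y, Prod.ext (sub_eq_zero.1 h).symm rfl⟩
    · rintro ⟨x, hx⟩
      rw [← hx]
      exact sub_self (D x)
  surjective z := ⟨(z, 0), by simp⟩

/-- The exact triple `ι_𝒞(D₁, D₂)` with operators `D₁`, `D₂ ∘ D₁ ⊕ id`, `D₂`. -/
abbrev compTriple (D₁ : FredholmOp X Y) (D₂ : FredholmOp Y Z) :
    ExactTriple (graphSES D₁.toCLM) (cographSES D₂.toCLM) where
  left := D₁
  mid := (D₂.comp D₁).stab Y
  right := D₂
  comm_i _ := rfl
  comm_j x := by
    change D₂.toCLM (D₁.toCLM x.1 - x.2) = D₂.toCLM (D₁.toCLM x.1) - D₂.toCLM x.2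
    rw [map_sub]

/-- The isomorphism `𝒞̃_{D₁,D₂} = Ψ_{ι_𝒞(D₁,D₂)} : λ(D₁) ⊗ λ(D₂) → λ(D₂ ∘ D₁)`, where
`λ(D₂ ∘ D₁ ⊕ id)` is identified with `λ(D₂ ∘ D₁)`. -/
def compIso (D₁ : FredholmOp X Y) (D₂ : FredholmOp Y Z) :
    DetLine D₁ ⊗[ℝ] DetLine D₂ ≃ₗ[ℝ] DetLine (D₂.comp D₁) :=
  (compTriple D₁ D₂).psi ≪≫ₗ (stabIso (D₂.comp D₁) Y).symm

end Triples

end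

end FredholmDet

/-!
For finite-dimensional spaces `K` and `E`, write `λ(K, E) = λ(K) ⊗ λ(E)^*`. A model of a Fredholm
operator `D` is a linear map `b : K → E` of finite-dimensional spaces with the same kernel and
cokernel as `D` (`Model`). It identifies `λ(D)` with `λ(K, E)`, where
`(-1)^(|z| |y|) x ⊗ y^*` corresponds to `(x ∧ z) ⊗ (z ∧ y)^*` for `z ∈ λ(Im b)`; the inverse of this
identification is `Model.det`.

The isomorphism `Ψ` becomes simple in terms of models. If the columns of an exact triple have models
that form a short exact sequence and induce the snake sequence of the triple (`ModelTriple`), then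
`Ψ` takes `(k' ⊗ e'^*) ⊗ (k'' ⊗ e''^*)` to `(k' ∧ k'') ⊗ (e' ∧ e'')^*`, up to the sign
`(-1)^(dim E' · ind D'')` (`ModelTriple.psi_det`). Indeed, `Im b` is isomorphic to
`Im b' × Im δ × Im b''`, and with compatible sections of all the maps involved both sides are
products of the same elements in the exterior algebras of `K` and `E`, up to the order of the
factors.

Models come from linear maps `T : E → Y` whose image spans `Y` together with that of `D`, with
`K = {(x, e) | D x = T e}` (`pullbackModel`). Such maps can be chosen compatibly for the columns of
an exact triple (`modelTriple_pullback`), and maps for `D₁` and `D₂` give one for `D₂ ∘ D₁` and a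
short exact sequence of models for the exact triple of the composition (`modelTriple_comp`). All of
the isomorphisms in the theorem are then products in exterior algebras, and the two sides are the two
ways to multiply the elements at the corners of a `3 × 3` diagram with exact rows and columns. By
graded commutativity these differ by a sign (`wedge_wedge_comm`), and the theorem reduces to an identity of
signs (`comp_psi_det`).
-/

open scoped TensorProduct
open Module

namespace FredholmDet

noncomputable section

/-! ### Signs and graded commutativity -/

theorem sgn_add (a b : ℤ) : sgn (a + b) = sgn a * sgn b := zpow_add _ _ _

theorem sgn_eq_of_even_sub {a b : ℤ} (h : Even (a - b)) : sgn a = sgn b := by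
  obtain ⟨c, hc⟩ := h
  have h1 : a = b + (c + c) := by omega
  have h2 : sgn c * sgn c = 1 := by rw [← sgn_add]; exact Even.neg_one_zpow ⟨c, rfl⟩
  rw [h1, sgn_add, sgn_add, h2, mul_one]

theorem sgn_smul_smul {M : Type*} [AddCommGroup M] [Module ℝ M] (a b : ℤ) (x : M) :
    sgn a • sgn b • x = sgn (a + b) • x := by
  rw [smul_smul, sgn_add]

theorem sgn_smul_self_smul {M : Type*} [AddCommGroup M] [Module ℝ M] (a : ℤ) (x : M) :
    sgn a • sgn a • x = x := by
  rw [sgn_smul_smul, sgn, Even.neg_one_zpow ⟨a, rfl⟩, one_smul]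

theorem map_sgn_smul {M N : Type*} [AddCommGroup M] [Module ℝ M] [AddCommGroup N] [Module ℝ N]
    (f : M ≃ₗ[ℝ] N) (a : ℤ) (x : M) : f (sgn a • x) = sgn a • f x :=
  map_smul f ((sgn a : ℝˣ) : ℝ) x

section Exterior

variable {V V' V'' W : Type*} [AddCommGroup V] [Module ℝ V] [AddCommGroup V'] [Module ℝ V']
  [AddCommGroup V''] [Module ℝ V''] [AddCommGroup W] [Module ℝ W]

theorem ι_mul_eq_of_mem_exteriorPower (v : V) {n : ℕ} {y : ExteriorAlgebra ℝ V}
    (hy : y ∈ ⋀[ℝ]^n V) :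
    ExteriorAlgebra.ι ℝ v * y = (-1 : ℝ) ^ n • (y * ExteriorAlgebra.ι ℝ v) := by
  induction n generalizing y with
  | zero =>
    obtain ⟨r, rfl⟩ := Submodule.mem_one.1 (show y ∈ (1 : Submodule ℝ _) from hy)
    rw [pow_zero, one_smul, Algebra.commutes]
  | succ n ih =>
    change y ∈ LinearMap.range (ExteriorAlgebra.ι ℝ) ^ (n + 1) at hy
    rw [pow_succ'] at hy
    refine Submodule.mul_induction_on hy ?_ ?_
    · rintro _ ⟨w, rfl⟩ z hz
      have hs := eq_neg_of_add_eq_zero_left (ExteriorAlgebra.ι_add_mul_swap (R := ℝ) v w)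
      rw [← mul_assoc, hs, neg_mul, mul_assoc, ih hz, mul_smul_comm, ← mul_assoc, pow_succ,
        mul_neg_one, neg_smul]
    · intro a b ha hb
      rw [mul_add, ha, hb, add_mul, smul_add]

/-- Graded commutativity of the exterior algebra. -/
theorem mul_comm_of_mem_exteriorPower {m n : ℕ} {x y : ExteriorAlgebra ℝ V}
    (hx : x ∈ ⋀[ℝ]^m V) (hy : y ∈ ⋀[ℝ]^n V) : x * y = sgn (m * n) • (y * x) := by
  suffices h : x * y = (-1 : ℝ) ^ (m * n) • (y * x) by
    rw [h, Units.smul_def, sgn]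
    congr 1
  induction m generalizing x with
  | zero =>
    obtain ⟨r, rfl⟩ := Submodule.mem_one.1 (show x ∈ (1 : Submodule ℝ _) from hx)
    rw [zero_mul, pow_zero, one_smul, Algebra.commutes]
  | succ m ih =>
    change x ∈ LinearMap.range (ExteriorAlgebra.ι ℝ) ^ (m + 1) at hx
    rw [pow_succ'] at hx
    refine Submodule.mul_induction_on hx ?_ ?_
    · rintro _ ⟨w, rfl⟩ z hz
      rw [mul_assoc, ih hz, mul_smul_comm, ← mul_assoc, ι_mul_eq_of_mem_exteriorPower w hy,
        smul_mul_assoc, smul_smul, mul_assoc, add_mul, one_mul, pow_add]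
    · intro a b ha hb
      rw [add_mul, ha, hb, mul_add, smul_add]

theorem mul_left_comm_of_mem_exteriorPower {m n : ℕ} {x y : ExteriorAlgebra ℝ V}
    (hx : x ∈ ⋀[ℝ]^m V) (hy : y ∈ ⋀[ℝ]^n V) (z : ExteriorAlgebra ℝ V) :
    x * (y * z) = sgn (m * n) • (y * (x * z)) := by
  rw [← mul_assoc, mul_comm_of_mem_exteriorPower hx hy, smul_mul_assoc, mul_assoc]

theorem map_comp_apply (g : V'' →ₗ[ℝ] W) (f : V →ₗ[ℝ] V'') (x : ExteriorAlgebra ℝ V) :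
    ExteriorAlgebra.map g (ExteriorAlgebra.map f x) = ExteriorAlgebra.map (g ∘ₗ f) x := by
  rw [← AlgHom.comp_apply, ExteriorAlgebra.map_comp_map]

/-! ### Short exact sequences and sections -/

/-- `0 → V' → V → V'' → 0` is exact. -/
structure IsSES (i : V' →ₗ[ℝ] V) (j : V →ₗ[ℝ] V'') : Prop where
  injective : Function.Injective i
  exact : Function.Exact i j
  surjective : Function.Surjective j

theorem exists_section (f : V →ₗ[ℝ] W) : ∃ σ : LinearMap.range f →ₗ[ℝ] V, ∀ z, f (σ z) = z :=
  ⟨sectionOf f.surjective_rangeRestrict, fun z =>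
    congrArg Subtype.val (sectionOf_apply f.surjective_rangeRestrict z)⟩

/-- A section of `j` can be prescribed on a subspace. -/
theorem exists_section_extending {j : V →ₗ[ℝ] V''} (hj : Function.Surjective j)
    (f : W →ₗ[ℝ] V'') (hf : Function.Injective f) (g : W →ₗ[ℝ] V) (h : ∀ x, j (g x) = f x) :
    ∃ σ : V'' →ₗ[ℝ] V, (∀ x, j (σ x) = x) ∧ ∀ x, σ (f x) = g x := by
  obtain ⟨ρ, hρ⟩ := f.exists_leftInverse_of_injective (LinearMap.ker_eq_bot.2 hf)
  have hρ' : ∀ x, ρ (f x) = x := LinearMap.congr_fun hρ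
  refine ⟨sectionOf hj + (g - sectionOf hj ∘ₗ f) ∘ₗ ρ, fun x => ?_, fun x => ?_⟩
  · simp [sectionOf_apply, h]
  · simp [hρ']

/-- A linear map into the kernel of `j` lifts along the injective map `i`. -/
theorem IsSES.exists_lift {i : V' →ₗ[ℝ] V} {j : V →ₗ[ℝ] V''} (h : IsSES i j)
    (f : W →ₗ[ℝ] V) (hf : ∀ x, j (f x) = 0) : ∃ g : W →ₗ[ℝ] V', ∀ x, i (g x) = f x := by
  obtain ⟨ρ, hρ⟩ := i.exists_leftInverse_of_injective (LinearMap.ker_eq_bot.2 h.injective)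
  refine ⟨ρ ∘ₗ f, fun x => ?_⟩
  obtain ⟨y, hy⟩ := (h.exact (f x)).1 (hf x)
  rw [LinearMap.comp_apply, ← hy, show ρ (i y) = y from LinearMap.congr_fun hρ y]

theorem IsSES.coprod_injective {i : V' →ₗ[ℝ] V} {j : V →ₗ[ℝ] V''} (h : IsSES i j)
    {σ : V'' →ₗ[ℝ] V} (hσ : ∀ x, j (σ x) = x) : Function.Injective (i.coprod σ) := by
  rw [← LinearMap.ker_eq_bot, LinearMap.ker_eq_bot']
  rintro ⟨x, y⟩ hxy
  rw [LinearMap.coprod_apply] at hxy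
  have h1 := congrArg j hxy
  rw [map_add, h.exact.apply_apply_eq_zero, hσ, zero_add, map_zero] at h1
  rw [h1, map_zero, add_zero] at hxy
  exact Prod.ext (h.injective (hxy.trans (map_zero i).symm)) h1

theorem exists_smul_topVec [FiniteDimensional ℝ V] (a : TopExt V) :
    ∃ c : ℝ, a = c • topVec (finBasis ℝ V) :=
  exists_smul_eq_topExt (topVec_ne_zero _) a

/-- The pairing of a short exact sequence can be computed with any section. -/
theorem coe_wedge_eq [FiniteDimensional ℝ V] [FiniteDimensional ℝ V'] [FiniteDimensional ℝ V'']
    (i : V' →ₗ[ℝ] V) (j : V →ₗ[ℝ] V'')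
    (hi : Function.Injective i) (hij : Function.Exact i j) (hj : Function.Surjective j)
    {σ : V'' →ₗ[ℝ] V} (hσ : ∀ x, j (σ x) = x) (a : TopExt V') (b : TopExt V'') :
    (wedge i j hi hij hj a b : ExteriorAlgebra ℝ V) =
      ExteriorAlgebra.map i a * ExteriorAlgebra.map σ b := by
  obtain ⟨c, rfl⟩ := exists_smul_topVec a
  obtain ⟨d, rfl⟩ := exists_smul_topVec b
  have h := wedge_topVec i j hi hij hj (finBasis ℝ V') (finBasis ℝ V'')
    (fun p => σ (finBasis ℝ V'' p)) (fun p => hσ _)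
  simp only [map_smul, LinearMap.smul_apply, Submodule.coe_smul, h, smul_mul_assoc,
    mul_smul_comm]
  congr 2
  change _ = ExteriorAlgebra.map i (ExteriorAlgebra.ιMulti ℝ _ (finBasis ℝ V')) *
    ExteriorAlgebra.map σ (ExteriorAlgebra.ιMulti ℝ _ (finBasis ℝ V''))
  rw [ExteriorAlgebra.map_apply_ιMulti, ExteriorAlgebra.map_apply_ιMulti]
  rfl

/-- The pairing `∧_V` of a short exact sequence. -/
def IsSES.wedge [FiniteDimensional ℝ V] {i : V' →ₗ[ℝ] V} {j : V →ₗ[ℝ] V''} (h : IsSES i j) :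
    TopExt V' →ₗ[ℝ] TopExt V'' →ₗ[ℝ] TopExt V :=
  FredholmDet.wedge i j h.injective h.exact h.surjective

theorem IsSES.wedge_ne_zero [FiniteDimensional ℝ V] [FiniteDimensional ℝ V']
    [FiniteDimensional ℝ V''] {i : V' →ₗ[ℝ] V} {j : V →ₗ[ℝ] V''} (h : IsSES i j)
    {a : TopExt V'} {b : TopExt V''} (ha : a ≠ 0) (hb : b ≠ 0) : h.wedge a b ≠ 0 :=
  FredholmDet.wedge_ne_zero _ _ _ _ _ ha hb

theorem IsSES.coe_wedge [FiniteDimensional ℝ V] [FiniteDimensional ℝ V']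
    [FiniteDimensional ℝ V''] {i : V' →ₗ[ℝ] V} {j : V →ₗ[ℝ] V''} (h : IsSES i j)
    {σ : V'' →ₗ[ℝ] V} (hσ : ∀ x, j (σ x) = x) (a : TopExt V') (b : TopExt V'') :
    (h.wedge a b : ExteriorAlgebra ℝ V) = ExteriorAlgebra.map i a * ExteriorAlgebra.map σ b :=
  coe_wedge_eq _ _ _ _ _ hσ a b

end Exterior

/-! ### The pairings of a `3 × 3` diagram -/

section Grid

variable {A' A A'' B' B B'' C' C C'' : Type*}
  [AddCommGroup A'] [Module ℝ A'] [FiniteDimensional ℝ A']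
  [AddCommGroup A] [Module ℝ A] [FiniteDimensional ℝ A]
  [AddCommGroup A''] [Module ℝ A''] [FiniteDimensional ℝ A'']
  [AddCommGroup B'] [Module ℝ B'] [FiniteDimensional ℝ B']
  [AddCommGroup B] [Module ℝ B] [FiniteDimensional ℝ B]
  [AddCommGroup B''] [Module ℝ B''] [FiniteDimensional ℝ B'']
  [AddCommGroup C'] [Module ℝ C'] [FiniteDimensional ℝ C']
  [AddCommGroup C] [Module ℝ C] [FiniteDimensional ℝ C]
  [AddCommGroup C''] [Module ℝ C''] [FiniteDimensional ℝ C'']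

/-- In a commutative diagram with exact rows `A' → A → A''`, `B' → B → B''`, `C' → C → C''` and
exact columns, the two ways to multiply elements of the four corners differ by the sign of the
interchange of `λ(A'')` and `λ(C')`. The sections that compute the four pairings can be chosen so
that both sides become the same product in the exterior algebra of `B`. -/
theorem wedge_wedge_comm {iA : A' →ₗ[ℝ] A} {jA : A →ₗ[ℝ] A''} {iB : B' →ₗ[ℝ] B}
    {jB : B →ₗ[ℝ] B''} {iC : C' →ₗ[ℝ] C} {jC : C →ₗ[ℝ] C''}
    {f' : A' →ₗ[ℝ] B'} {g' : B' →ₗ[ℝ] C'} {f : A →ₗ[ℝ] B} {g : B →ₗ[ℝ] C}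
    {f'' : A'' →ₗ[ℝ] B''} {g'' : B'' →ₗ[ℝ] C''}
    (hA : IsSES iA jA) (hB : IsSES iB jB) (hC : IsSES iC jC)
    (h' : IsSES f' g') (h : IsSES f g) (h'' : IsSES f'' g'')
    (e₁ : ∀ x, f (iA x) = iB (f' x)) (e₂ : ∀ x, f'' (jA x) = jB (f x))
    (e₃ : ∀ x, g (iB x) = iC (g' x)) (e₄ : ∀ x, g'' (jB x) = jC (g x))
    (a' : TopExt A') (a'' : TopExt A'') (c' : TopExt C') (c'' : TopExt C'') :
    h.wedge (hA.wedge a' a'') (hC.wedge c' c'') =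
      sgn (finrank ℝ A'' * finrank ℝ C') •
        hB.wedge (h'.wedge a' c') (h''.wedge a'' c'') := by
  have sA := sectionOf_apply hA.surjective
  have s' := sectionOf_apply h'.surjective
  have s'' := sectionOf_apply h''.surjective
  -- a section of `B → B''` that extends the one of `A → A''`
  obtain ⟨sB, hsB, hsB'⟩ := exists_section_extending hB.surjective f'' h''.injective
    (f ∘ₗ sectionOf hA.surjective) (fun x => by
      rw [LinearMap.comp_apply, ← e₂, sA])
  have hsC : ∀ x, jC ((g ∘ₗ sB ∘ₗ sectionOf h''.surjective) x) = x := fun x => by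
    simp only [LinearMap.comp_apply]
    rw [← e₄, hsB, s'']
  -- a section of `B → C` that extends the one of `B' → C'`, and agrees with `sB` on `C''`
  obtain ⟨σ, hσ, hσ'⟩ := exists_section_extending h.surjective
    (iC.coprod (g ∘ₗ sB ∘ₗ sectionOf h''.surjective))
    (hC.coprod_injective hsC)
    ((iB ∘ₗ sectionOf h'.surjective).coprod (sB ∘ₗ sectionOf h''.surjective)) (by
      rintro ⟨x, y⟩
      simp [e₃, s'])
  have hσC : ∀ x, σ (iC x) = iB (sectionOf h'.surjective x) := fun x => by
    simpa using hσ' (x, 0)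
  have hσC' : ∀ x, σ (g (sB (sectionOf h''.surjective x))) = sB (sectionOf h''.surjective x) :=
    fun x => by simpa using hσ' (0, x)
  apply Subtype.ext
  rw [h.coe_wedge hσ, hA.coe_wedge sA, hC.coe_wedge hsC]
  change _ = sgn _ • (hB.wedge (h'.wedge a' c') (h''.wedge a'' c'') : ExteriorAlgebra ℝ B)
  rw [hB.coe_wedge hsB, h'.coe_wedge s', h''.coe_wedge s'']
  simp only [map_mul, map_comp_apply]
  have E1 : f ∘ₗ iA = iB ∘ₗ f' := LinearMap.ext e₁
  have E2 : f ∘ₗ sectionOf hA.surjective = sB ∘ₗ f'' := LinearMap.ext fun x => (hsB' x).symm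
  have E3 : σ ∘ₗ iC = iB ∘ₗ sectionOf h'.surjective := LinearMap.ext hσC
  have E4 : σ ∘ₗ g ∘ₗ sB ∘ₗ sectionOf h''.surjective = sB ∘ₗ sectionOf h''.surjective :=
    LinearMap.ext hσC'
  rw [E1, E2, E3, E4, mul_assoc, mul_assoc, mul_left_comm_of_mem_exteriorPower
    (map_mem_exteriorPower _ a''.2) (map_mem_exteriorPower _ c'.2), mul_smul_comm]

end Grid

/-! ### Finite-dimensional models of Fredholm operators -/

section Model

variable {X Y K E M : Type*} [NormedAddCommGroup X] [NormedSpace ℝ X]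
  [NormedAddCommGroup Y] [NormedSpace ℝ Y]
  [AddCommGroup K] [Module ℝ K] [AddCommGroup E] [Module ℝ E] [AddCommGroup M] [Module ℝ M]

theorem coe_topMap (φ : K ≃ₗ[ℝ] E) (z : TopExt K) :
    (topMap φ z : ExteriorAlgebra ℝ E) = ExteriorAlgebra.map (φ : K →ₗ[ℝ] E) z := rfl

/-- A model of the Fredholm operator `D`: an exact sequence `0 → κ(D) → K → E → 𝔠(D) → 0`. Thus
`b : K → E` is a linear map with the same kernel and cokernel as `D`; it will be used with
finite-dimensional `K` and `E`. -/
structure Model (D : FredholmOp X Y) (K E : Type*) [AddCommGroup K] [Module ℝ K]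
    [AddCommGroup E] [Module ℝ E] where
  a : D.ker →ₗ[ℝ] K
  b : K →ₗ[ℝ] E
  c : E →ₗ[ℝ] D.coker
  injective : Function.Injective a
  exact_ab : Function.Exact a b
  exact_bc : Function.Exact b c
  surjective : Function.Surjective c

namespace Model

variable {D : FredholmOp X Y} (m : Model D K E)

theorem sesKer : IsSES m.a m.b.rangeRestrict :=
  ⟨m.injective, ExactTriple.exact_rangeRestrict m.exact_ab, m.b.surjective_rangeRestrict⟩

theorem sesCoker : IsSES (LinearMap.range m.b).subtype m.c :=
  ⟨Subtype.val_injective, ExactTriple.exact_range_subtype m.exact_bc, m.surjective⟩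

variable [FiniteDimensional ℝ K] [FiniteDimensional ℝ E]

/-- The element of `λ(D)` that corresponds to `k ⊗ e^*` under the isomorphism
`λ(D) → λ(K) ⊗ λ(E)^*` which takes `(-1)^(dim Im b · dim 𝔠(D)) x ⊗ y^*` to
`(x ∧ z) ⊗ (z ∧ y)^*` for every nonzero `z ∈ λ(Im b)`, see `det_wedge`. -/
def det (k : TopExt K) (e : TopExt E) : DetLine D :=
  open ExactTriple in
  (dualVec (m.sesKer.wedge (gen _) (gen _)) k * (dualVec (m.sesCoker.wedge (gen _) (gen _)) e)⁻¹) •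
    sgn (finrank ℝ (LinearMap.range m.b) * finrank ℝ D.coker) •
      DetLine.mk D (gen _) (dualVec (gen _))

theorem det_smul_smul (α β : ℝ) (k : TopExt K) (e : TopExt E) :
    m.det (α • k) (β • e) = (α * β⁻¹) • m.det k e := by
  simp only [det, map_smul, smul_eq_mul, mul_inv, smul_smul]
  congr 1
  ring

theorem det_sgn_smul (α β : ℤ) (k : TopExt K) (e : TopExt E) :
    m.det (sgn α • k) (sgn β • e) = sgn (α + β) • m.det k e := by
  have h : ((sgn β : ℝˣ) : ℝ)⁻¹ = (sgn β : ℝˣ) := by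
    have h2 : sgn β * sgn β = 1 := by rw [← sgn_add]; exact Even.neg_one_zpow ⟨β, rfl⟩
    rw [← Units.val_inv_eq_inv_val, inv_eq_of_mul_eq_one_left h2]
  rw [Units.smul_def, Units.smul_def, Units.smul_def, det_smul_smul, h, sgn_add, Units.val_mul]

theorem det_wedge (x : TopExt D.ker) {z : TopExt (LinearMap.range m.b)} (hz : z ≠ 0)
    {y : TopExt D.coker} (hy : y ≠ 0) :
    m.det (m.sesKer.wedge x z) (m.sesCoker.wedge z y) =
      sgn (finrank ℝ (LinearMap.range m.b) * finrank ℝ D.coker) • DetLine.mk D x (dualVec y) := by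
  obtain ⟨α, rfl⟩ := exists_smul_eq_topExt (ExactTriple.gen_ne_zero _) x
  obtain ⟨β, rfl⟩ := exists_smul_eq_topExt (ExactTriple.gen_ne_zero _) z
  obtain ⟨γ, rfl⟩ := exists_smul_eq_topExt (ExactTriple.gen_ne_zero _) y
  have hβ : β ≠ 0 := (smul_ne_zero_iff.1 hz).1
  have hγ : γ ≠ 0 := (smul_ne_zero_iff.1 hy).1
  simp only [map_smul, LinearMap.smul_apply, smul_smul]
  rw [det_smul_smul, dualVec_smul hγ (ExactTriple.gen_ne_zero _), det,
    dualVec_self (m.sesKer.wedge_ne_zero (ExactTriple.gen_ne_zero _) (ExactTriple.gen_ne_zero _)),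
    dualVec_self (m.sesCoker.wedge_ne_zero (ExactTriple.gen_ne_zero _)
      (ExactTriple.gen_ne_zero _))]
  simp only [map_smul, inv_one, mul_one, one_smul, smul_comm _ (sgn _), smul_smul]
  congr 2
  field_simp

theorem det_ne_zero {k : TopExt K} {e : TopExt E} (hk : k ≠ 0) (he : e ≠ 0) : m.det k e ≠ 0 := by
  have h1 := m.sesKer.wedge_ne_zero (ExactTriple.gen_ne_zero D.ker)
    (ExactTriple.gen_ne_zero (LinearMap.range m.b))
  have h2 := m.sesCoker.wedge_ne_zero (ExactTriple.gen_ne_zero (LinearMap.range m.b))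
    (ExactTriple.gen_ne_zero D.coker)
  obtain ⟨α, rfl⟩ := exists_smul_eq_topExt h1 k
  obtain ⟨β, rfl⟩ := exists_smul_eq_topExt h2 e
  rw [det_smul_smul, det_wedge _ _ (ExactTriple.gen_ne_zero _) (ExactTriple.gen_ne_zero _)]
  have h3 : DetLine.mk D (ExactTriple.gen _) (dualVec (ExactTriple.gen _)) ≠ 0 :=
    tmul_ne_zero (ExactTriple.gen_ne_zero _) (dualVec_ne_zero (ExactTriple.gen_ne_zero _))
  exact smul_ne_zero (mul_ne_zero (smul_ne_zero_iff.1 hk).1 (inv_ne_zero (smul_ne_zero_iff.1 he).1))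
    ((smul_ne_zero_iff_ne _).2 h3)

/-- A variant of `det_wedge` in which the image of `b` is parametrized by a space `M` by way of a
linear map `T : M → K`, and the products are formed in the exterior algebras of `K` and `E`. -/
theorem det_eq [FiniteDimensional ℝ M] (T : M →ₗ[ℝ] K) (hT : Function.Injective (m.b ∘ₗ T))
    (hT' : LinearMap.range (m.b ∘ₗ T) = LinearMap.range m.b)
    {σ : D.coker →ₗ[ℝ] E} (hσ : ∀ y, m.c (σ y) = y)
    (x : TopExt D.ker) {z : TopExt M} (hz : z ≠ 0) {y : TopExt D.coker} (hy : y ≠ 0)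
    {k : TopExt K} {e : TopExt E}
    (hk : (k : ExteriorAlgebra ℝ K) = ExteriorAlgebra.map m.a x * ExteriorAlgebra.map T z)
    (he : (e : ExteriorAlgebra ℝ E) =
      ExteriorAlgebra.map (m.b ∘ₗ T) z * ExteriorAlgebra.map σ y) :
    m.det k e = sgn (finrank ℝ M * finrank ℝ D.coker) • DetLine.mk D x (dualVec y) := by
  let φ : M ≃ₗ[ℝ] LinearMap.range m.b :=
    LinearEquiv.ofInjective _ hT ≪≫ₗ LinearEquiv.ofEq _ _ hT'
  have hφ : ∀ z, (φ z : E) = m.b (T z) := fun z => rfl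
  have hs : ∀ w, m.b.rangeRestrict ((T ∘ₗ φ.symm.toLinearMap) w) = w := fun w => by
    apply Subtype.ext
    change m.b (T (φ.symm w)) = w
    rw [← hφ, φ.apply_symm_apply]
  have hk' : k = m.sesKer.wedge x (topMap φ z) := by
    apply Subtype.ext
    rw [m.sesKer.coe_wedge hs, hk]
    rw [coe_topMap, map_comp_apply, LinearMap.comp_assoc, LinearEquiv.comp_coe,
      LinearEquiv.self_trans_symm, LinearEquiv.refl_toLinearMap, LinearMap.comp_id]
  have he' : e = m.sesCoker.wedge (topMap φ z) y := by
    apply Subtype.ext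
    rw [m.sesCoker.coe_wedge hσ, he]
    rw [coe_topMap, map_comp_apply]
    rfl
  rw [hk', he', det_wedge _ _ ((map_ne_zero_iff _ (topMap φ).injective).2 hz) hy, φ.finrank_eq]

end Model

end Model

/-! ### The isomorphism `Ψ` in terms of models -/

theorem isSES_inl_snd (V W : Type*) [AddCommGroup V] [Module ℝ V] [AddCommGroup W] [Module ℝ W] :
    IsSES (LinearMap.inl ℝ V W) (LinearMap.snd ℝ V W) :=
  ⟨LinearMap.inl_injective, .inl_snd, LinearMap.snd_surjective⟩

section Triple

variable {X' X X'' Y' Y Y'' K' K K'' E' E E'' : Type*}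
  [NormedAddCommGroup X'] [NormedSpace ℝ X'] [NormedAddCommGroup X] [NormedSpace ℝ X]
  [NormedAddCommGroup X''] [NormedSpace ℝ X''] [NormedAddCommGroup Y'] [NormedSpace ℝ Y']
  [NormedAddCommGroup Y] [NormedSpace ℝ Y] [NormedAddCommGroup Y''] [NormedSpace ℝ Y'']
  [AddCommGroup K'] [Module ℝ K'] [AddCommGroup K] [Module ℝ K]
  [AddCommGroup K''] [Module ℝ K''] [AddCommGroup E'] [Module ℝ E']
  [AddCommGroup E] [Module ℝ E] [AddCommGroup E''] [Module ℝ E'']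
  {r : BanachSES X' X X''} {s : BanachSES Y' Y Y''}

/-- A short exact sequence of models of the columns of the exact triple `t`: its long exact
sequence is identified with the snake sequence of `t`. -/
structure ModelTriple (t : ExactTriple r s) (m' : Model t.left K' E') (m : Model t.mid K E)
    (m'' : Model t.right K'' E'') (iK : K' →ₗ[ℝ] K) (jK : K →ₗ[ℝ] K'') (iE : E' →ₗ[ℝ] E)
    (jE : E →ₗ[ℝ] E'') : Prop where
  sesK : IsSES iK jK
  sesE : IsSES iE jE
  comm_ia : ∀ x, iK (m'.a x) = m.a (t.kerI x)
  comm_ja : ∀ x, jK (m.a x) = m''.a (t.kerJ x)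
  comm_ib : ∀ k, iE (m'.b k) = m.b (iK k)
  comm_jb : ∀ k, jE (m.b k) = m''.b (jK k)
  comm_ic : ∀ e, m.c (iE e) = t.cokerI (m'.c e)
  comm_jc : ∀ e, m''.c (jE e) = t.cokerJ (m.c e)
  delta : ∀ x'' k e, jK k = m''.a x'' → iE e = m.b k → t.delta x'' = m'.c e

namespace ModelTriple

variable {t : ExactTriple r s} {m' : Model t.left K' E'} {m : Model t.mid K E}
  {m'' : Model t.right K'' E''} {iK : K' →ₗ[ℝ] K} {jK : K →ₗ[ℝ] K''} {iE : E' →ₗ[ℝ] E}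
  {jE : E →ₗ[ℝ] E''}

section Param

variable {σ' : LinearMap.range m'.b →ₗ[ℝ] K'} {σ'' : LinearMap.range m''.b →ₗ[ℝ] K''}
  {sK : K'' →ₗ[ℝ] K} {sv : LinearMap.range t.delta →ₗ[ℝ] t.right.ker}

/-- The image of `K → E` is isomorphic to `Im b' × Im δ × Im b''`. This is the lift to `K` of such
an isomorphism that is determined by sections of `b'`, of `b''`, of `K → K''` and of `δ`. -/
def param (m' : Model t.left K' E') (m'' : Model t.right K'' E'') (iK : K' →ₗ[ℝ] K)
    (σ' : LinearMap.range m'.b →ₗ[ℝ] K') (σ'' : LinearMap.range m''.b →ₗ[ℝ] K'')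
    (sK : K'' →ₗ[ℝ] K) (sv : LinearMap.range t.delta →ₗ[ℝ] t.right.ker) :
    LinearMap.range m'.b × (LinearMap.range t.delta × LinearMap.range m''.b) →ₗ[ℝ] K :=
  (iK ∘ₗ σ').coprod ((sK ∘ₗ m''.a ∘ₗ sv).coprod (sK ∘ₗ σ''))

theorem param_apply (z : LinearMap.range m'.b) (v : LinearMap.range t.delta)
    (z' : LinearMap.range m''.b) : param m' m'' iK σ' σ'' sK sv (z, v, z') =
      iK (σ' z) + (sK (m''.a (sv v)) + sK (σ'' z')) := rfl

theorem injective_param (h : ModelTriple t m' m m'' iK jK iE jE)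
    (hσ' : ∀ z, m'.b (σ' z) = z) (hσ'' : ∀ z, m''.b (σ'' z) = z)
    (hsK : ∀ x, jK (sK x) = x) (hsv : ∀ v, t.delta (sv v) = v) :
    Function.Injective (m.b ∘ₗ param m' m'' iK σ' σ'' sK sv) := by
  rw [← LinearMap.ker_eq_bot, LinearMap.ker_eq_bot']
  rintro ⟨z, v, z'⟩ hz
  rw [LinearMap.comp_apply, param_apply] at hz
  have h1 := congrArg jE hz
  simp only [h.comm_jb, map_add, h.sesK.exact.apply_apply_eq_zero, hsK,
    m''.exact_ab.apply_apply_eq_zero, hσ'', zero_add, map_zero] at h1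
  have h2 : z' = 0 := Subtype.ext h1
  rw [h2, map_zero, map_zero, add_zero, map_add, ← h.comm_ib, hσ'] at hz
  have h3 : v = 0 := by
    apply Subtype.ext
    rw [← hsv, h.delta (sv v) (sK (m''.a (sv v))) (-z) (hsK _) (by
      rw [map_neg, neg_eq_of_add_eq_zero_right hz]), map_neg,
      (m'.exact_bc z).2 z.2, neg_zero]
    rfl
  rw [h3, map_zero, map_zero, map_zero, map_zero, add_zero] at hz
  rw [h2, h3, show z = 0 from Subtype.ext (h.sesE.injective (hz.trans (map_zero iE).symm))]
  rfl

/-- An element of `K` is reduced to one of `κ(D)` by subtracting its components in `Im b''`, in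
`Im δ` and in `Im b'`, in this order. -/
theorem range_param (h : ModelTriple t m' m m'' iK jK iE jE)
    (hσ' : ∀ z, m'.b (σ' z) = z) (hσ'' : ∀ z, m''.b (σ'' z) = z)
    (hsK : ∀ x, jK (sK x) = x) (hsv : ∀ v, t.delta (sv v) = v) :
    LinearMap.range (m.b ∘ₗ param m' m'' iK σ' σ'' sK sv) = LinearMap.range m.b := by
  refine le_antisymm (LinearMap.range_comp_le_range _ _) ?_
  rintro _ ⟨k, rfl⟩
  let z' : LinearMap.range m''.b := ⟨m''.b (jK k), LinearMap.mem_range_self _ _⟩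
  obtain ⟨x'', hx''⟩ := (m''.exact_ab (jK k - σ'' z')).1 (by rw [map_sub, hσ'', sub_self])
  let v : LinearMap.range t.delta := ⟨t.delta x'', LinearMap.mem_range_self _ _⟩
  obtain ⟨x, hx⟩ := (t.exact_kerJ_delta (x'' - sv v)).1 (by rw [map_sub, hsv, sub_self])
  obtain ⟨k', hk'⟩ := (h.sesK.exact (k - (sK (m''.a (sv v)) + sK (σ'' z')) - m.a x)).1 (by
    rw [map_sub, map_sub, map_add, hsK, hsK, h.comm_ja, hx, map_sub, hx'']
    abel)
  let z : LinearMap.range m'.b := ⟨m'.b k', LinearMap.mem_range_self _ _⟩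
  refine ⟨(z, v, z'), ?_⟩
  rw [LinearMap.comp_apply, param_apply, map_add, ← h.comm_ib, hσ']
  change iE (m'.b k') + _ = _
  rw [h.comm_ib, hk', map_sub, m.exact_ab.apply_apply_eq_zero, sub_zero, map_sub, sub_add_cancel]

end Param

/-- Sections of the maps in a short exact sequence of models and in its long exact sequence. The
last five fields say that the ways in which `Im 𝔧_X`, `Im δ`, `Im b''`, `Im 𝔦_Y` and `𝔠(D'')` are
thereby lifted to `K` or `E` agree. -/
structure Sections (m' : Model t.left K' E') (m : Model t.mid K E) (m'' : Model t.right K'' E'')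
    (iK : K' →ₗ[ℝ] K) (jK : K →ₗ[ℝ] K'') (iE : E' →ₗ[ℝ] E) (jE : E →ₗ[ℝ] E'') where
  σ' : LinearMap.range m'.b →ₗ[ℝ] K'
  σ'' : LinearMap.range m''.b →ₗ[ℝ] K''
  su : LinearMap.range t.kerJ →ₗ[ℝ] t.mid.ker
  sv : LinearMap.range t.delta →ₗ[ℝ] t.right.ker
  sw : LinearMap.range t.cokerI →ₗ[ℝ] t.left.coker
  sy : t.right.coker →ₗ[ℝ] t.mid.coker
  sK : K'' →ₗ[ℝ] K
  sE : E'' →ₗ[ℝ] E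
  sc' : t.left.coker →ₗ[ℝ] E'
  sc'' : t.right.coker →ₗ[ℝ] E''
  sc : t.mid.coker →ₗ[ℝ] E
  hσ' : ∀ z, m'.b (σ' z) = z
  hσ'' : ∀ z, m''.b (σ'' z) = z
  hsu : ∀ z, t.kerJ (su z) = z
  hsv : ∀ z, t.delta (sv z) = z
  hsw : ∀ z, t.cokerI (sw z) = z
  hsy : ∀ z, t.cokerJ (sy z) = z
  hsK : ∀ z, jK (sK z) = z
  hsE : ∀ z, jE (sE z) = z
  hsc' : ∀ z, m'.c (sc' z) = z
  hsc'' : ∀ z, m''.c (sc'' z) = z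
  hsc : ∀ z, m.c (sc z) = z
  sK_u : sK ∘ₗ m''.a ∘ₗ (LinearMap.range t.kerJ).subtype = m.a ∘ₗ su
  sc'_v : iE ∘ₗ sc' ∘ₗ (LinearMap.range t.delta).subtype = m.b ∘ₗ sK ∘ₗ m''.a ∘ₗ sv
  sE_z : sE ∘ₗ (LinearMap.range m''.b).subtype = m.b ∘ₗ sK ∘ₗ σ''
  sc_w : sc ∘ₗ (LinearMap.range t.cokerI).subtype = iE ∘ₗ sc' ∘ₗ sw
  sc_y : sc ∘ₗ sy = sE ∘ₗ sc''

theorem isSES_cokerI (t : ExactTriple r s) : IsSES (LinearMap.range t.cokerI).subtype t.cokerJ :=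
  ⟨Subtype.val_injective, ExactTriple.exact_range_subtype t.exact_cokerI_cokerJ,
    t.cokerJ_surjective⟩

/-- Each section is chosen as an extension of what earlier ones prescribe on a subspace. -/
theorem nonempty_sections (h : ModelTriple t m' m m'' iK jK iE jE) :
    Nonempty (Sections m' m m'' iK jK iE jE) := by
  -- sections of `b'`, of `b''` and of the maps of the snake sequence
  obtain ⟨σ', hσ'⟩ := exists_section m'.b
  obtain ⟨σ'', hσ''⟩ := exists_section m''.b
  obtain ⟨su, hsu⟩ := exists_section t.kerJ
  obtain ⟨sv, hsv⟩ := exists_section t.delta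
  obtain ⟨sw, hsw⟩ := exists_section t.cokerI
  have hsc'' := sectionOf_apply m''.surjective
  -- a section of `K → K''` that is compatible with the one of `κ(D) → Im 𝔧_X`
  obtain ⟨sK, hsK, hsK'⟩ := exists_section_extending h.sesK.surjective
    (m''.a ∘ₗ (LinearMap.range t.kerJ).subtype)
    (m''.injective.comp Subtype.val_injective) (m.a ∘ₗ su) (fun x => by
      rw [LinearMap.comp_apply, h.comm_ja, hsu]
      rfl)
  -- the snake construction lifts `Im δ ⊆ 𝔠(D')` to `E'`
  obtain ⟨g, hg⟩ := h.sesE.exists_lift (m.b ∘ₗ sK ∘ₗ m''.a ∘ₗ sv) (fun x => by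
    simp only [LinearMap.comp_apply]
    rw [h.comm_jb, hsK, m''.exact_ab.apply_apply_eq_zero])
  obtain ⟨sc', hsc', hsc'₁⟩ := exists_section_extending m'.surjective
    (LinearMap.range t.delta).subtype Subtype.val_injective g (fun x => by
      rw [← h.delta (sv x) (sK (m''.a (sv x))) (g x) (hsK _) (hg x), hsv]
      rfl)
  -- a section of `E → E''` that is compatible with the lift of `Im b''` to `K`
  obtain ⟨sE, hsE, hsE'⟩ := exists_section_extending h.sesE.surjective
    (LinearMap.range m''.b).subtype Subtype.val_injective (m.b ∘ₗ sK ∘ₗ σ'') (fun x => by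
      simp only [LinearMap.comp_apply]
      rw [h.comm_jb, hsK, hσ'']
      rfl)
  have hsy : ∀ x, t.cokerJ ((m.c ∘ₗ sE ∘ₗ sectionOf m''.surjective) x) = x := fun x => by
    simp only [LinearMap.comp_apply]
    rw [← h.comm_jc, hsE, hsc'']
  -- a section of `E → 𝔠(D)` that is compatible with all the others
  obtain ⟨sc, hsc, hsc₁⟩ := exists_section_extending m.surjective
    ((LinearMap.range t.cokerI).subtype.coprod (m.c ∘ₗ sE ∘ₗ sectionOf m''.surjective))
    ((isSES_cokerI t).coprod_injective hsy)
    ((iE ∘ₗ sc' ∘ₗ sw).coprod (sE ∘ₗ sectionOf m''.surjective)) (by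
      rintro ⟨x, y⟩
      simp [h.comm_ic, hsc', hsw])
  refine ⟨⟨σ', σ'', su, sv, sw, m.c ∘ₗ sE ∘ₗ sectionOf m''.surjective, sK, sE, sc',
    sectionOf m''.surjective, sc, hσ', hσ'', hsu, hsv, hsw, hsy, hsK, hsE, hsc', hsc'', hsc,
    LinearMap.ext hsK', LinearMap.ext fun x => (congrArg iE (hsc'₁ x)).trans (hg x),
    LinearMap.ext hsE', LinearMap.ext fun x => ?_, LinearMap.ext fun x => ?_⟩⟩
  · simpa using hsc₁ (x, 0)
  · simpa using hsc₁ (0, x)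

theorem map_wedge_param [FiniteDimensional ℝ K'] [FiniteDimensional ℝ K'']
    {V : Type*} [AddCommGroup V] [Module ℝ V] (f : K →ₗ[ℝ] V)
    (S : Sections m' m m'' iK jK iE jE)
    (v : TopExt (LinearMap.range t.delta)) (z' : TopExt (LinearMap.range m'.b))
    (z'' : TopExt (LinearMap.range m''.b)) :
    ExteriorAlgebra.map (f ∘ₗ param m' m'' iK S.σ' S.σ'' S.sK S.sv)
        ((isSES_inl_snd _ _).wedge z' ((isSES_inl_snd _ _).wedge v z'')) =
      ExteriorAlgebra.map (f ∘ₗ iK ∘ₗ S.σ') z' *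
        (ExteriorAlgebra.map (f ∘ₗ S.sK ∘ₗ m''.a ∘ₗ S.sv) v *
          ExteriorAlgebra.map (f ∘ₗ S.sK ∘ₗ S.σ'') z'') := by
  rw [(isSES_inl_snd (LinearMap.range m'.b)
      (LinearMap.range t.delta × LinearMap.range m''.b)).coe_wedge (σ := LinearMap.inr ℝ _ _)
      (fun x => rfl),
    (isSES_inl_snd (LinearMap.range t.delta)
      (LinearMap.range m''.b)).coe_wedge (σ := LinearMap.inr ℝ _ _) (fun x => rfl),
    map_mul, map_mul, map_mul, map_comp_apply, map_comp_apply, map_comp_apply, map_comp_apply,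
    map_comp_apply]
  congr 3 <;> simp [param, LinearMap.comp_assoc]

/-- In `λ(K)`, the products `(x ∧ z') ∧ ((u ∧ v) ∧ z'')` and `(x ∧ u) ∧ (z' ∧ v ∧ z'')` differ by
the interchange of `z'` and `u`. -/
theorem coe_wedge_ker [FiniteDimensional ℝ K'] [FiniteDimensional ℝ K]
    [FiniteDimensional ℝ K''] (h : ModelTriple t m' m m'' iK jK iE jE)
    (S : Sections m' m m'' iK jK iE jE) (x : TopExt t.left.ker)
    (u : TopExt (LinearMap.range t.kerJ))
    (v : TopExt (LinearMap.range t.delta)) (z' : TopExt (LinearMap.range m'.b))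
    (z'' : TopExt (LinearMap.range m''.b)) :
    ((sgn (finrank ℝ (LinearMap.range m'.b) * finrank ℝ (LinearMap.range t.kerJ)) •
      h.sesK.wedge (m'.sesKer.wedge x z') (m''.sesKer.wedge (t.wedgeKerRight u v) z'') :
        TopExt K) : ExteriorAlgebra ℝ K) =
      ExteriorAlgebra.map m.a (t.wedgeKer x u) *
        ExteriorAlgebra.map (param m' m'' iK S.σ' S.σ'' S.sK S.sv)
          ((isSES_inl_snd _ _).wedge z' ((isSES_inl_snd _ _).wedge v z'')) := by
  have hx := coe_wedge_eq t.kerI t.kerJ.rangeRestrict t.kerI_injective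
    (ExactTriple.exact_rangeRestrict t.exact_kerI_kerJ) t.kerJ.surjective_rangeRestrict
    (fun x => Subtype.ext (S.hsu x)) x u
  have hu := coe_wedge_eq (LinearMap.range t.kerJ).subtype t.delta.rangeRestrict
    Subtype.val_injective (ExactTriple.exact_range_subtype (ExactTriple.exact_rangeRestrict
      t.exact_kerJ_delta)) t.delta.surjective_rangeRestrict
    (fun x => Subtype.ext (S.hsv x)) u v
  have hT := map_wedge_param LinearMap.id S v z' z''
  simp only [LinearMap.id_comp] at hT
  rw [hT, ExactTriple.wedgeKer, hx]
  change sgn _ • (h.sesK.wedge _ _ : ExteriorAlgebra ℝ K) = _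
  rw [h.sesK.coe_wedge S.hsK, m'.sesKer.coe_wedge (fun x => Subtype.ext (S.hσ' x)),
    m''.sesKer.coe_wedge (fun x => Subtype.ext (S.hσ'' x)), ExactTriple.wedgeKerRight, hu]
  simp only [map_mul, map_comp_apply]
  rw [S.sK_u, show iK ∘ₗ m'.a = m.a ∘ₗ t.kerI from LinearMap.ext h.comm_ia]
  simp only [mul_assoc]
  rw [← mul_smul_comm]
  congr 1
  rw [mul_left_comm_of_mem_exteriorPower (map_mem_exteriorPower (m.a ∘ₗ S.su) u.2)
    (map_mem_exteriorPower (iK ∘ₗ S.σ') z'.2), mul_comm (_ : ℤ)]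

/-- In `λ(E)`, the products `(z' ∧ (v ∧ w)) ∧ (z'' ∧ y)` and `(z' ∧ v ∧ z'') ∧ (w ∧ y)` differ by
the interchange of `z''` and `w`. -/
theorem coe_wedge_coker [FiniteDimensional ℝ K'] [FiniteDimensional ℝ K'']
    [FiniteDimensional ℝ E'] [FiniteDimensional ℝ E] [FiniteDimensional ℝ E'']
    (h : ModelTriple t m' m m'' iK jK iE jE)
    (S : Sections m' m m'' iK jK iE jE) (v : TopExt (LinearMap.range t.delta))
    (w : TopExt (LinearMap.range t.cokerI)) (y : TopExt t.right.coker)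
    (z' : TopExt (LinearMap.range m'.b)) (z'' : TopExt (LinearMap.range m''.b)) :
    ((sgn (finrank ℝ (LinearMap.range t.cokerI) * finrank ℝ (LinearMap.range m''.b)) •
      h.sesE.wedge (m'.sesCoker.wedge z' (t.wedgeCokerLeft v w)) (m''.sesCoker.wedge z'' y) :
        TopExt E) : ExteriorAlgebra ℝ E) =
      ExteriorAlgebra.map (m.b ∘ₗ param m' m'' iK S.σ' S.σ'' S.sK S.sv)
          ((isSES_inl_snd _ _).wedge z' ((isSES_inl_snd _ _).wedge v z'')) *
        ExteriorAlgebra.map S.sc (t.wedgeCoker w y) := by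
  have hw := coe_wedge_eq (LinearMap.range t.delta).subtype t.cokerI.rangeRestrict
    Subtype.val_injective (ExactTriple.exact_range_subtype (ExactTriple.exact_rangeRestrict
      t.exact_delta_cokerI)) t.cokerI.surjective_rangeRestrict
    (fun x => Subtype.ext (S.hsw x)) v w
  have hy := (isSES_cokerI t).coe_wedge S.hsy w y
  rw [map_wedge_param, show t.wedgeCoker w y = (isSES_cokerI t).wedge w y from rfl, hy]
  change sgn _ • (h.sesE.wedge _ _ : ExteriorAlgebra ℝ E) = _
  rw [h.sesE.coe_wedge S.hsE, m'.sesCoker.coe_wedge S.hsc', m''.sesCoker.coe_wedge S.hsc'',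
    ExactTriple.wedgeCokerLeft, hw]
  simp only [map_mul, map_comp_apply]
  rw [S.sc'_v, S.sE_z, S.sc_w, S.sc_y,
    show m.b ∘ₗ iK ∘ₗ S.σ' = iE ∘ₗ (LinearMap.range m'.b).subtype from
      LinearMap.ext fun x => (h.comm_ib _).symm.trans (congrArg iE (S.hσ' x))]
  simp only [mul_assoc]
  rw [← mul_smul_comm, ← mul_smul_comm]
  congr 2
  rw [mul_left_comm_of_mem_exteriorPower (map_mem_exteriorPower (m.b ∘ₗ S.sK ∘ₗ S.σ'') z''.2)
    (map_mem_exteriorPower (iE ∘ₗ S.sc' ∘ₗ S.sw) w.2), mul_comm (_ : ℤ)]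

variable [FiniteDimensional ℝ K'] [FiniteDimensional ℝ K] [FiniteDimensional ℝ K'']
  [FiniteDimensional ℝ E'] [FiniteDimensional ℝ E] [FiniteDimensional ℝ E'']

/-- Both sides are computed in the exterior algebras of `K` and `E` with compatible sections, where
they become products of the same elements. The signs come from the interchange of `z'` with `u` and
of `z''` with `w`, and from the sign in `Model.det_wedge`. -/
theorem det_wedge_wedge (h : ModelTriple t m' m m'' iK jK iE jE)
    (x : TopExt t.left.ker) (u : TopExt (LinearMap.range t.kerJ))
    {v : TopExt (LinearMap.range t.delta)} (hv : v ≠ 0)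
    {w : TopExt (LinearMap.range t.cokerI)} (hw : w ≠ 0)
    {y : TopExt t.right.coker} (hy : y ≠ 0)
    {z' : TopExt (LinearMap.range m'.b)} (hz' : z' ≠ 0)
    {z'' : TopExt (LinearMap.range m''.b)} (hz'' : z'' ≠ 0) :
    m.det (h.sesK.wedge (m'.sesKer.wedge x z') (m''.sesKer.wedge (t.wedgeKerRight u v) z''))
      (h.sesE.wedge (m'.sesCoker.wedge z' (t.wedgeCokerLeft v w)) (m''.sesCoker.wedge z'' y)) =
    sgn (finrank ℝ (LinearMap.range m'.b) * finrank ℝ (LinearMap.range t.kerJ) +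
      finrank ℝ (LinearMap.range t.cokerI) * finrank ℝ (LinearMap.range m''.b) +
      (finrank ℝ (LinearMap.range m'.b) + (finrank ℝ (LinearMap.range t.delta) +
        finrank ℝ (LinearMap.range m''.b))) * finrank ℝ t.mid.coker) •
      DetLine.mk t.mid (t.wedgeKer x u) (dualVec (t.wedgeCoker w y)) := by
  obtain ⟨S⟩ := h.nonempty_sections
  let T := param m' m'' iK S.σ' S.σ'' S.sK S.sv
  -- the element of `λ(Im b)` that is built from `z'`, `v` and `z''`
  let z := (isSES_inl_snd (LinearMap.range m'.b) (LinearMap.range t.delta ×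
    LinearMap.range m''.b)).wedge z'
      ((isSES_inl_snd (LinearMap.range t.delta) (LinearMap.range m''.b)).wedge v z'')
  have hz : z ≠ 0 := (isSES_inl_snd _ _).wedge_ne_zero hz'
    ((isSES_inl_snd _ _).wedge_ne_zero hv hz'')
  have hk := h.coe_wedge_ker S x u v z' z''
  have he := h.coe_wedge_coker S v w y z' z''
  have hd := m.det_eq T (h.injective_param S.hσ' S.hσ'' S.hsK S.hsv)
    (h.range_param S.hσ' S.hσ'' S.hsK S.hsv) S.hsc (t.wedgeKer x u) hz
    (y := t.wedgeCoker w y) ((isSES_cokerI t).wedge_ne_zero hw hy) hk he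
  rw [m.det_sgn_smul, finrank_prod, finrank_prod] at hd
  rw [sgn_add, mul_smul]
  push_cast at hd
  rw [← hd, sgn_smul_self_smul]

/-- The case of `psi_det` in which `Ψ` is given by its defining formula. -/
theorem psi_det_wedge (h : ModelTriple t m' m m'' iK jK iE jE)
    {x : TopExt t.left.ker} (hx : x ≠ 0) {u : TopExt (LinearMap.range t.kerJ)} (hu : u ≠ 0)
    {v : TopExt (LinearMap.range t.delta)} (hv : v ≠ 0)
    {w : TopExt (LinearMap.range t.cokerI)} (hw : w ≠ 0)
    {y : TopExt t.right.coker} (hy : y ≠ 0)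
    {z' : TopExt (LinearMap.range m'.b)} (hz' : z' ≠ 0)
    {z'' : TopExt (LinearMap.range m''.b)} (hz'' : z'' ≠ 0) :
    t.psi (m'.det (m'.sesKer.wedge x z') (m'.sesCoker.wedge z' (t.wedgeCokerLeft v w)) ⊗ₜ
      m''.det (m''.sesKer.wedge (t.wedgeKerRight u v) z'') (m''.sesCoker.wedge z'' y)) =
    sgn (finrank ℝ E' * t.right.ind) •
      m.det (h.sesK.wedge (m'.sesKer.wedge x z') (m''.sesKer.wedge (t.wedgeKerRight u v) z''))
        (h.sesE.wedge (m'.sesCoker.wedge z' (t.wedgeCokerLeft v w))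
          (m''.sesCoker.wedge z'' y)) := by
  have hpsi := t.psi_source hx hu hv hw hy
  have hvw : t.wedgeCokerLeft v w ≠ 0 := wedge_ne_zero _ _ _ _ _ hv hw
  have n1 := finrank_eq_add_of_exact m'.sesCoker.injective m'.sesCoker.exact m'.sesCoker.surjective
  have n2 := finrank_eq_add_of_exact (LinearMap.range t.delta).subtype_injective
    (ExactTriple.exact_range_subtype (ExactTriple.exact_rangeRestrict
      t.exact_delta_cokerI)) t.cokerI.surjective_rangeRestrict
  have n3 := finrank_eq_add_of_exact (LinearMap.range t.kerJ).subtype_injective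
    (ExactTriple.exact_range_subtype (ExactTriple.exact_rangeRestrict
      t.exact_kerJ_delta)) t.delta.surjective_rangeRestrict
  have n4 := finrank_eq_add_of_exact (isSES_cokerI t).injective (isSES_cokerI t).exact
    (isSES_cokerI t).surjective
  rw [h.det_wedge_wedge x u hv hw hy hz' hz'', m'.det_wedge x hz' hvw,
    m''.det_wedge _ hz'' hy, sgn_smul_smul]
  simp only [Units.smul_def (sgn _), TensorProduct.tmul_smul, ← TensorProduct.smul_tmul',
    map_smul]
  simp only [← Units.smul_def (sgn _)]
  change sgn _ • sgn _ • t.psi (t.source _ _ _ _ _) = _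
  rw [hpsi, ExactTriple.target, sgn_smul_smul, sgn_smul_smul]
  congr 1
  rw [ExactTriple.eps, FredholmOp.ind, ← n1, ← n2, ← n3, ← n4]
  push_cast
  generalize (finrank ℝ (LinearMap.range m'.b) : ℤ) = a'
  generalize (finrank ℝ (LinearMap.range m''.b) : ℤ) = a''
  generalize (finrank ℝ (LinearMap.range t.kerJ) : ℤ) = nu
  generalize (finrank ℝ (LinearMap.range t.delta) : ℤ) = nv
  generalize (finrank ℝ (LinearMap.range t.cokerI) : ℤ) = nw
  generalize (finrank ℝ t.right.coker : ℤ) = ny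
  refine sgn_eq_of_even_sub ?_
  exact ⟨-(a' * nu + a'' * nw), by ring⟩

/-- The isomorphism `Ψ` in terms of models is the multiplication of `λ(K') ⊗ λ(E')^*` and
`λ(K'') ⊗ λ(E'')^*`, with the sign `(-1)^(dim E' · ind D'')`. -/
theorem psi_det (h : ModelTriple t m' m m'' iK jK iE jE) (k' : TopExt K') (e' : TopExt E')
    (k'' : TopExt K'') (e'' : TopExt E'') :
    t.psi (m'.det k' e' ⊗ₜ m''.det k'' e'') =
      sgn (finrank ℝ E' * t.right.ind) • m.det (h.sesK.wedge k' k'') (h.sesE.wedge e' e'') := by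
  obtain ⟨x, hx⟩ := exists_topExt_ne_zero t.left.ker
  obtain ⟨u, hu⟩ := exists_topExt_ne_zero (LinearMap.range t.kerJ)
  obtain ⟨v, hv⟩ := exists_topExt_ne_zero (LinearMap.range t.delta)
  obtain ⟨w, hw⟩ := exists_topExt_ne_zero (LinearMap.range t.cokerI)
  obtain ⟨y, hy⟩ := exists_topExt_ne_zero t.right.coker
  obtain ⟨z', hz'⟩ := exists_topExt_ne_zero (LinearMap.range m'.b)
  obtain ⟨z'', hz''⟩ := exists_topExt_ne_zero (LinearMap.range m''.b)
  have hvw : t.wedgeCokerLeft v w ≠ 0 := wedge_ne_zero _ _ _ _ _ hv hw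
  have huv : t.wedgeKerRight u v ≠ 0 := wedge_ne_zero _ _ _ _ _ hu hv
  have key := h.psi_det_wedge hx hu hv hw hy hz' hz''
  obtain ⟨α', rfl⟩ := exists_smul_eq_topExt (m'.sesKer.wedge_ne_zero hx hz') k'
  obtain ⟨β', rfl⟩ := exists_smul_eq_topExt (m'.sesCoker.wedge_ne_zero hz' hvw) e'
  obtain ⟨α'', rfl⟩ := exists_smul_eq_topExt (m''.sesKer.wedge_ne_zero huv hz'') k''
  obtain ⟨β'', rfl⟩ := exists_smul_eq_topExt (m''.sesCoker.wedge_ne_zero hz'' hy) e''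
  simp only [map_smul, LinearMap.smul_apply, smul_smul, Model.det_smul_smul,
    ← TensorProduct.smul_tmul', TensorProduct.tmul_smul]
  rw [key, smul_comm (sgn _)]
  congr 1
  ring

end ModelTriple

end Triple

/-! ### Stabilization -/

section Stab

variable {X Y K E : Type*} [NormedAddCommGroup X] [NormedSpace ℝ X]
  [NormedAddCommGroup Y] [NormedSpace ℝ Y]
  [AddCommGroup K] [Module ℝ K] [AddCommGroup E] [Module ℝ E]

theorem dualVec_topMap [FiniteDimensional ℝ K] [FiniteDimensional ℝ E] (φ : K ≃ₗ[ℝ] E)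
    {z : TopExt K} (hz : z ≠ 0) :
    dualVec (topMap φ z) = dualVec z ∘ₗ (topMap φ).symm.toLinearMap := by
  have hz' : topMap φ z ≠ 0 := (map_ne_zero_iff _ (topMap φ).injective).2 hz
  apply LinearMap.ext
  intro w
  obtain ⟨c, rfl⟩ := exists_smul_eq_topExt hz' w
  simp [dualVec_self hz, dualVec_self hz']

/-- A model of `D` is a model of `D ⊕ id_Z`. -/
def Model.stab {D : FredholmOp X Y} (m : Model D K E) (Z : Type*) [NormedAddCommGroup Z]
    [NormedSpace ℝ Z] : Model (D.stab Z) K E where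
  a := m.a ∘ₗ (stabKer D Z).symm.toLinearMap
  b := m.b
  c := (stabCoker D Z).toLinearMap ∘ₗ m.c
  injective := m.injective.comp (stabKer D Z).symm.injective
  exact_ab k := (m.exact_ab k).trans (by
    rw [← LinearMap.coe_range, ← LinearMap.coe_range, LinearMap.range_comp,
      LinearEquiv.range, Submodule.map_top])
  exact_bc e := by
    rw [LinearMap.comp_apply, LinearEquiv.coe_coe, map_eq_zero_iff _ (stabCoker D Z).injective]
    exact m.exact_bc e
  surjective := (stabCoker D Z).surjective.comp m.surjective

theorem stabIso_mk (D : FredholmOp X Y) (Z : Type*) [NormedAddCommGroup Z] [NormedSpace ℝ Z]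
    (x : TopExt D.ker) {y : TopExt D.coker} (hy : y ≠ 0) :
    stabIso D Z (DetLine.mk D x (dualVec y)) =
      DetLine.mk (D.stab Z) (topMap (stabKer D Z) x) (dualVec (topMap (stabCoker D Z) y)) := by
  rw [dualVec_topMap _ hy]
  rfl

/-- The identification of `λ(D)` with `λ(D ⊕ id_Z)` is the identity in terms of models. -/
theorem stabIso_det [FiniteDimensional ℝ K] [FiniteDimensional ℝ E] {D : FredholmOp X Y}
    (m : Model D K E) (Z : Type*) [NormedAddCommGroup Z] [NormedSpace ℝ Z] (k : TopExt K)
    (e : TopExt E) : stabIso D Z (m.det k e) = (m.stab Z).det k e := by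
  obtain ⟨x, hx⟩ := exists_topExt_ne_zero D.ker
  obtain ⟨y, hy⟩ := exists_topExt_ne_zero D.coker
  obtain ⟨z, hz⟩ := exists_topExt_ne_zero (LinearMap.range m.b)
  have hy' : topMap (stabCoker D Z) y ≠ 0 :=
    (map_ne_zero_iff _ (topMap (stabCoker D Z)).injective).2 hy
  obtain ⟨σ, hσ⟩ := exists_section m.b
  have hs := sectionOf_apply m.surjective
  have hbσ : m.b ∘ₗ σ = (LinearMap.range m.b).subtype := LinearMap.ext hσ
  have key := (m.stab Z).det_eq σ (hbσ ▸ Subtype.val_injective)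
    ((congrArg LinearMap.range hbσ).trans (Submodule.range_subtype _))
    (σ := sectionOf m.surjective ∘ₗ (stabCoker D Z).symm.toLinearMap)
    (fun w => by
      change stabCoker D Z (m.c (sectionOf m.surjective ((stabCoker D Z).symm w))) = w
      rw [hs, LinearEquiv.apply_symm_apply])
    (topMap (stabKer D Z) x) hz hy' (k := m.sesKer.wedge x z) (e := m.sesCoker.wedge z y)
    (by
      rw [m.sesKer.coe_wedge (σ := σ) (fun x => Subtype.ext (hσ x)), coe_topMap, map_comp_apply]
      congr 3)
    (by
      change _ = ExteriorAlgebra.map (m.b ∘ₗ σ) _ * _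
      rw [m.sesCoker.coe_wedge hs, coe_topMap, map_comp_apply, hbσ, LinearMap.comp_assoc,
        LinearEquiv.comp_coe, LinearEquiv.self_trans_symm, LinearEquiv.refl_toLinearMap,
        LinearMap.comp_id])
  obtain ⟨α, rfl⟩ := exists_smul_eq_topExt (m.sesKer.wedge_ne_zero hx hz) k
  obtain ⟨β, rfl⟩ := exists_smul_eq_topExt (m.sesCoker.wedge_ne_zero hz hy) e
  have hfr : sgn (finrank ℝ (LinearMap.range m.b) * finrank ℝ D.coker) =
      sgn (finrank ℝ (LinearMap.range m.b) * finrank ℝ (D.stab Z).coker) := by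
    rw [(stabCoker D Z).finrank_eq]
  rw [m.det_smul_smul, Model.det_smul_smul, map_smul, m.det_wedge x hz hy, key, hfr, map_sgn_smul,
    stabIso_mk _ _ _ hy]

end Stab

/-! ### Models from surjective extensions -/

section Pullback

variable {X Y E : Type*} [AddCommGroup X] [Module ℝ X]
  [AddCommGroup Y] [Module ℝ Y] [AddCommGroup E] [Module ℝ E]

/-- The fibre product `{(x, e) | D x = T e}`. -/
abbrev pullback (D : X →ₗ[ℝ] Y) (T : E →ₗ[ℝ] Y) : Submodule ℝ (X × E) :=
  LinearMap.eqLocus (D ∘ₗ LinearMap.fst ℝ X E) (T ∘ₗ LinearMap.snd ℝ X E)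

/-- The images of `D` and `T` span the common target. -/
def Transverse (D : X →ₗ[ℝ] Y) (T : E →ₗ[ℝ] Y) : Prop := ∀ y, ∃ x e, D x + T e = y

theorem Transverse.comp_coprod {Z F : Type*} [AddCommGroup Z] [Module ℝ Z] [AddCommGroup F]
    [Module ℝ F] {D₁ : X →ₗ[ℝ] Y} {T₁ : E →ₗ[ℝ] Y} {D₂ : Y →ₗ[ℝ] Z} {T₂ : F →ₗ[ℝ] Z}
    (h₁ : Transverse D₁ T₁) (h₂ : Transverse D₂ T₂) :
    Transverse (D₂ ∘ₗ D₁) ((D₂ ∘ₗ T₁).coprod T₂) := by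
  intro z
  obtain ⟨y, f, rfl⟩ := h₂ z
  obtain ⟨x, e, rfl⟩ := h₁ y
  exact ⟨x, (e, f), by simp [add_assoc]⟩

end Pullback

section PullbackModel

variable {X X' X'' Y Y' Y'' Z E E' E'' F : Type*}
  [NormedAddCommGroup X'] [NormedSpace ℝ X'] [NormedAddCommGroup X] [NormedSpace ℝ X]
  [NormedAddCommGroup X''] [NormedSpace ℝ X''] [NormedAddCommGroup Y'] [NormedSpace ℝ Y']
  [NormedAddCommGroup Y] [NormedSpace ℝ Y] [NormedAddCommGroup Y''] [NormedSpace ℝ Y'']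
  [NormedAddCommGroup Z] [NormedSpace ℝ Z]
  [AddCommGroup E'] [Module ℝ E'] [AddCommGroup E] [Module ℝ E] [AddCommGroup E''] [Module ℝ E'']
  [AddCommGroup F] [Module ℝ F]

/-- The underlying linear map of a Fredholm operator. -/
abbrev FredholmOp.lin (D : FredholmOp X Y) : X →ₗ[ℝ] Y := D.toCLM.toLinearMap

/-- The map `x ↦ (x, 0)` from the kernel of `D` to `{(x, e) | D x = T e}`. -/
def pullbackInl (D : FredholmOp X Y) (T : E →ₗ[ℝ] Y) : D.ker →ₗ[ℝ] pullback D.lin T :=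
  (LinearMap.inl ℝ X E).restrict fun x (hx : D.lin x = 0) => by
    change D.lin x = T 0
    rw [hx, map_zero]

/-- The projection of `{(x, e) | D x = T e}` to `E`. -/
def pullbackSnd (D : FredholmOp X Y) (T : E →ₗ[ℝ] Y) : pullback D.lin T →ₗ[ℝ] E :=
  LinearMap.snd ℝ X E ∘ₗ (pullback D.lin T).subtype

theorem exact_pullbackInl_pullbackSnd (D : FredholmOp X Y) (T : E →ₗ[ℝ] Y) :
    Function.Exact (pullbackInl D T) (pullbackSnd D T) := by
  rintro ⟨⟨x, e⟩, hx⟩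
  change D.lin x = T e at hx
  constructor
  · intro he
    change e = 0 at he
    subst he
    exact ⟨⟨x, hx.trans (map_zero T)⟩, rfl⟩
  · rintro ⟨y, hy⟩
    exact (congrArg (fun k => k.1.2) hy).symm

instance [FiniteDimensional ℝ E] (D : FredholmOp X Y) (T : E →ₗ[ℝ] Y) :
    FiniteDimensional ℝ (pullback D.lin T) :=
  .of_exact (ExactTriple.exact_rangeRestrict (exact_pullbackInl_pullbackSnd D T))
    (pullbackSnd D T).surjective_rangeRestrict

/-- The model `{(x, e) | D x = T e} → E` of `D` that is given by a linear map `T : E → Y` whose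
image spans `Y` together with the image of `D`. -/
def pullbackModel (D : FredholmOp X Y) (T : E →ₗ[ℝ] Y) (h : Transverse D.lin T) :
    Model D (pullback D.lin T) E where
  a := pullbackInl D T
  b := pullbackSnd D T
  c := D.range.mkQ ∘ₗ T
  injective _ _ h := Subtype.ext (congrArg (fun k => k.1.1) h)
  exact_ab := exact_pullbackInl_pullbackSnd D T
  exact_bc e := by
    refine (Submodule.Quotient.mk_eq_zero D.range).trans ⟨?_, ?_⟩
    · rintro ⟨x, hx⟩
      exact ⟨⟨(x, e), hx⟩, rfl⟩
    · rintro ⟨⟨⟨x, e⟩, hx⟩, rfl⟩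
      exact ⟨x, hx⟩
  surjective q := by
    obtain ⟨y, rfl⟩ := D.range.mkQ_surjective q
    obtain ⟨x, e, rfl⟩ := h y
    exact ⟨e, (Submodule.Quotient.eq _).2 ⟨-x, by simp⟩⟩

theorem exists_transverse (D : FredholmOp X Y) : ∃ T : D.coker →ₗ[ℝ] Y, Transverse D.lin T := by
  refine ⟨sectionOf D.range.mkQ_surjective, fun y => ?_⟩
  obtain ⟨x, hx⟩ := (Submodule.Quotient.eq D.range).1
    (sectionOf_apply D.range.mkQ_surjective (D.range.mkQ y)).symm
  exact ⟨x, D.range.mkQ y, by rw [hx, sub_add_cancel]⟩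

/-- The linear map between fibre products that is induced by `f` and `g`. -/
def pullbackMap {D : X →ₗ[ℝ] Y} {T : E →ₗ[ℝ] Y} {D' : X' →ₗ[ℝ] Y'} {T' : E' →ₗ[ℝ] Y'}
    (f : X →ₗ[ℝ] X') (g : E →ₗ[ℝ] E') (h : ∀ x e, D x = T e → D' (f x) = T' (g e)) :
    pullback D T →ₗ[ℝ] pullback D' T' :=
  (f.prodMap g).restrict fun x hx => h x.1 x.2 hx

section Triple

variable {r : BanachSES X' X X''} {s : BanachSES Y' Y Y''} (t : ExactTriple r s)
  {iE : E' →ₗ[ℝ] E} {jE : E →ₗ[ℝ] E''} {T' : E' →ₗ[ℝ] Y'} {T : E →ₗ[ℝ] Y} {T'' : E'' →ₗ[ℝ] Y''}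

/-- The map `(x', e') ↦ (𝔦_X x', i e')` between the models of `D'` and `D`. -/
def tripleI (hi : ∀ e, s.i (T' e) = T (iE e)) :
    pullback t.left.lin T' →ₗ[ℝ] pullback t.mid.lin T :=
  pullbackMap r.i.toLinearMap iE fun x e h => by
    rw [← hi, ← h]
    exact t.comm_i x

/-- The map `(x, e) ↦ (𝔧_X x, j e)` between the models of `D` and `D''`. -/
def tripleJ (hj : ∀ e, s.j (T e) = T'' (jE e)) :
    pullback t.mid.lin T →ₗ[ℝ] pullback t.right.lin T'' :=
  pullbackMap r.j.toLinearMap jE fun x e h => by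
    rw [← hj, ← h]
    exact t.comm_j x

/-- Transversality of the outer columns implies that of the middle one. -/
theorem transverse_mid (hE : IsSES iE jE) (hi : ∀ e, s.i (T' e) = T (iE e))
    (hj : ∀ e, s.j (T e) = T'' (jE e)) (h' : Transverse t.left.lin T')
    (h'' : Transverse t.right.lin T'') : Transverse t.mid.lin T := by
  intro y
  obtain ⟨x'', e'', hy⟩ := h'' (s.j y)
  obtain ⟨x, rfl⟩ := r.surjective x''
  obtain ⟨e, rfl⟩ := hE.surjective e''
  obtain ⟨y', hy'⟩ := (s.exact (y - (t.mid.toCLM x + T e))).1 (by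
    rw [map_sub, map_add, ← t.comm_j, hj]
    exact sub_eq_zero.2 hy.symm)
  obtain ⟨x', e', rfl⟩ := h' y'
  refine ⟨x + r.i x', e + iE e', ?_⟩
  have h1 : t.mid.lin (r.i x') + T (iE e') = y - (t.mid.lin x + T e) := by
    rw [← hi]
    exact (congrArg (· + s.i (T' e')) (t.comm_i x')).trans ((map_add s.i _ _).symm.trans hy')
  rw [map_add, map_add, add_add_add_comm, h1, add_sub_cancel]

/-- Compatible linear maps to the bottom row of an exact triple give a short exact sequence of
models of its columns. -/
theorem modelTriple_pullback (hE : IsSES iE jE) (hi : ∀ e, s.i (T' e) = T (iE e))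
    (hj : ∀ e, s.j (T e) = T'' (jE e)) (h' : Transverse t.left.lin T')
    (h : Transverse t.mid.lin T) (h'' : Transverse t.right.lin T'') :
    ModelTriple t (pullbackModel t.left T' h') (pullbackModel t.mid T h)
      (pullbackModel t.right T'' h'') (tripleI t hi) (tripleJ t hj) iE jE where
  sesK := by
    refine ⟨?_, ?_, ?_⟩
    · intro k₁ k₂ hk
      exact Subtype.ext (Prod.ext (r.injective (congrArg (fun k => k.1.1) hk))
        (hE.injective (congrArg (fun k => k.1.2) hk)))
    · rintro ⟨⟨x, e⟩, hx⟩
      change t.mid.toCLM x = T e at hx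
      constructor
      · intro hk
        obtain ⟨x', rfl⟩ := (r.exact x).1 (congrArg (fun k => k.1.1) hk)
        obtain ⟨e', rfl⟩ := (hE.exact e).1 (congrArg (fun k => k.1.2) hk)
        refine ⟨⟨(x', e'), ?_⟩, rfl⟩
        apply s.injective
        rw [t.comm_i, ← hi] at hx
        exact hx
      · rintro ⟨k', hk'⟩
        rw [← hk']
        exact Subtype.ext (Prod.ext (r.exact.apply_apply_eq_zero _)
          (hE.exact.apply_apply_eq_zero _))
    · rintro ⟨⟨x'', e''⟩, hx⟩
      change t.right.toCLM x'' = T'' e'' at hx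
      obtain ⟨x, rfl⟩ := r.surjective x''
      obtain ⟨e, rfl⟩ := hE.surjective e''
      -- `D x - T e` comes from `Y'`, where it can be absorbed
      obtain ⟨y', hy'⟩ := (s.exact (t.mid.toCLM x - T e)).1 (by
        rw [map_sub, ← t.comm_j, hj, hx, sub_self])
      obtain ⟨x', e', rfl⟩ := h' y'
      refine ⟨⟨(x - r.i x', e + iE e'), ?_⟩, ?_⟩
      · change t.mid.toCLM (x - r.i x') = T (e + iE e')
        rw [map_add s.i, hi] at hy'
        rw [map_sub, map_add, t.comm_i, sub_eq_iff_eq_add, add_assoc, ← sub_eq_iff_eq_add', ← hy',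
          add_comm]
        rfl
      · refine Subtype.ext (Prod.ext ?_ ?_)
        · change r.j (x - r.i x') = r.j x
          rw [map_sub, r.exact.apply_apply_eq_zero, sub_zero]
        · change jE (e + iE e') = jE e
          rw [map_add, hE.exact.apply_apply_eq_zero, add_zero]
  sesE := hE
  comm_ia x := Subtype.ext (Prod.ext rfl (map_zero iE))
  comm_ja x := Subtype.ext (Prod.ext rfl (map_zero jE))
  comm_ib _ := rfl
  comm_jb _ := rfl
  comm_ic e := congrArg t.mid.range.mkQ (hi e).symm
  comm_jc e := congrArg t.right.range.mkQ (hj e).symm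
  delta := by
    rintro x'' ⟨⟨x, e₀⟩, hx⟩ e hk he
    change t.mid.toCLM x = T e₀ at hx
    change iE e = e₀ at he
    refine t.delta_eq x'' x (congrArg (fun k => k.1.1) hk) (T' e) ?_
    rw [hi, he, hx]

end Triple

section Comp

variable (D₁ : FredholmOp X Y) (D₂ : FredholmOp Y Z) (T₁ : E →ₗ[ℝ] Y) (T₂ : F →ₗ[ℝ] Z)

/-- The map `(x, e) ↦ (x, (e, 0))` between the models of `D₁` and `D₂ ∘ D₁`. -/
def compI : pullback D₁.lin T₁ →ₗ[ℝ] pullback (D₂.comp D₁).lin ((D₂.lin ∘ₗ T₁).coprod T₂) :=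
  pullbackMap LinearMap.id (LinearMap.inl ℝ E F) fun x e h => by
    change D₂.lin (D₁.lin x) = D₂.lin (T₁ e) + T₂ 0
    rw [h, map_zero, add_zero]

/-- The map `(x, (e, f)) ↦ (D₁ x - T₁ e, f)` between the models of `D₂ ∘ D₁` and `D₂`. -/
def compJ : pullback (D₂.comp D₁).lin ((D₂.lin ∘ₗ T₁).coprod T₂) →ₗ[ℝ] pullback D₂.lin T₂ :=
  (((D₁.lin ∘ₗ LinearMap.fst ℝ X (E × F)) -
      (T₁ ∘ₗ LinearMap.fst ℝ E F ∘ₗ LinearMap.snd ℝ X (E × F))).prod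
    (LinearMap.snd ℝ E F ∘ₗ LinearMap.snd ℝ X (E × F))).restrict (by
      rintro ⟨x, e, f⟩ h
      change D₂.lin (D₁.lin x) = D₂.lin (T₁ e) + T₂ f at h
      change D₂.lin (D₁.lin x - T₁ e) = T₂ f
      rw [map_sub, h, add_sub_cancel_left])

variable {D₁ D₂ T₁ T₂}

/-- The models of `D₁`, `D₂ ∘ D₁` and `D₂` that are given by `T₁`, by
`(e, f) ↦ D₂ (T₁ e) + T₂ f` and by `T₂` form a short exact sequence of models of the columns of the
exact triple `ι_𝒞(D₁, D₂)`. -/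
theorem modelTriple_comp (h₁ : Transverse D₁.lin T₁) (h₂ : Transverse D₂.lin T₂) :
    ModelTriple (compTriple D₁ D₂) (pullbackModel D₁ T₁ h₁)
      ((pullbackModel (D₂.comp D₁) _ (h₁.comp_coprod h₂)).stab Y) (pullbackModel D₂ T₂ h₂)
      (compI D₁ D₂ T₁ T₂) (compJ D₁ D₂ T₁ T₂) (LinearMap.inl ℝ E F) (LinearMap.snd ℝ E F) where
  sesK := by
    refine ⟨?_, ?_, ?_⟩
    · intro k₁ k₂ hk
      exact Subtype.ext (Prod.ext (congrArg (fun k => k.1.1) hk)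
        (congrArg (fun k => k.1.2.1) hk))
    · rintro ⟨⟨x, e, f⟩, hx⟩
      constructor
      · intro hk
        have hf : f = 0 := congrArg (fun k => k.1.2) hk
        have he : D₁.lin x - T₁ e = 0 := congrArg (fun k => k.1.1) hk
        subst hf
        exact ⟨⟨(x, e), sub_eq_zero.1 he⟩, rfl⟩
      · rintro ⟨⟨⟨y, e'⟩, hy⟩, hk⟩
        rw [← hk]
        exact Subtype.ext (Prod.ext (sub_eq_zero.2 hy) rfl)
    · rintro ⟨⟨y, f⟩, hy⟩
      change D₂.lin y = T₂ f at hy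
      obtain ⟨x, e, rfl⟩ := h₁ y
      refine ⟨⟨(x, (-e, f)), ?_⟩, Subtype.ext (Prod.ext ?_ rfl)⟩
      · change D₂.lin (D₁.lin x) = D₂.lin (T₁ (-e)) + T₂ f
        rw [← hy, ← map_add, map_neg, add_comm (D₁.lin x), neg_add_cancel_left]
      · change D₁.lin x - T₁ (-e) = D₁.lin x + T₁ e
        rw [map_neg, sub_neg_eq_add]
  sesE := isSES_inl_snd E F
  comm_ia x := Subtype.ext rfl
  comm_ja x := by
    refine Subtype.ext (Prod.ext ?_ rfl)
    change D₁.lin x.1.1 - T₁ 0 = D₁.lin x.1.1 - x.1.2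
    rw [map_zero, show x.1.2 = 0 from congrArg Prod.snd x.2]
  comm_ib _ := rfl
  comm_jb _ := rfl
  comm_ic e := by
    refine (Submodule.Quotient.eq _).2 ⟨(0, -T₁ e), ?_⟩
    change (D₂.lin (D₁.lin 0), -T₁ e) = (D₂.lin (T₁ e) + T₂ 0, (0 : Y)) - (D₂.lin (T₁ e), T₁ e)
    simp
  comm_jc e := by
    refine (Submodule.Quotient.eq _).2 ⟨-T₁ e.1, ?_⟩
    change D₂.lin (-T₁ e.1) = T₂ e.2 - ((D₂.lin (T₁ e.1) + T₂ e.2) - D₂.lin 0)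
    simp
  delta := by
    rintro y ⟨⟨x, e₀, f⟩, hx⟩ e hk he
    change ((e, 0) : E × F) = (e₀, f) at he
    obtain ⟨rfl, rfl⟩ := Prod.ext_iff.1 he
    have hy : D₁.lin x - T₁ e = y := congrArg (fun k => k.1.1) hk
    -- `(0, -y)` is a lift of `y` along `(x, y) ↦ D₁ x - y`
    rw [(compTriple D₁ D₂).delta_eq y (0, -y) (by simp [graphSES]) (-y) (by
      refine Prod.ext ?_ rfl
      change D₂.lin (-y) = D₂.lin (D₁.lin 0)
      rw [map_neg, show D₂.lin y = 0 from y.2]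
      simp)]
    refine (Submodule.Quotient.eq _).2 ⟨-x, ?_⟩
    change D₁.lin (-x) = -(y : Y) - T₁ e
    rw [← hy, map_neg]
    abel

/-- The composition isomorphism in terms of models. -/
theorem compIso_det [FiniteDimensional ℝ E] [FiniteDimensional ℝ F] (h₁ : Transverse D₁.lin T₁)
    (h₂ : Transverse D₂.lin T₂) (k₁ : TopExt (pullback D₁.lin T₁)) (e₁ : TopExt E)
    (k₂ : TopExt (pullback D₂.lin T₂)) (e₂ : TopExt F) :
    compIso D₁ D₂ ((pullbackModel D₁ T₁ h₁).det k₁ e₁ ⊗ₜ (pullbackModel D₂ T₂ h₂).det k₂ e₂) =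
      sgn (finrank ℝ E * D₂.ind) • (pullbackModel (D₂.comp D₁) _ (h₁.comp_coprod h₂)).det
        ((modelTriple_comp h₁ h₂).sesK.wedge k₁ k₂) ((isSES_inl_snd E F).wedge e₁ e₂) := by
  rw [compIso, LinearEquiv.trans_apply, LinearEquiv.symm_apply_eq, map_sgn_smul, stabIso_det]
  exact (modelTriple_comp h₁ h₂).psi_det k₁ e₁ k₂ e₂

end Comp

end PullbackModel

/-! ### Products of exact sequences and additivity of the index -/

theorem IsSES.prodMap {A A' A'' B B' B'' : Type*} [AddCommGroup A] [Module ℝ A]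
    [AddCommGroup A'] [Module ℝ A'] [AddCommGroup A''] [Module ℝ A''] [AddCommGroup B] [Module ℝ B]
    [AddCommGroup B'] [Module ℝ B'] [AddCommGroup B''] [Module ℝ B'']
    {i : A' →ₗ[ℝ] A} {j : A →ₗ[ℝ] A''} {k : B' →ₗ[ℝ] B} {l : B →ₗ[ℝ] B''} (h : IsSES i j)
    (h' : IsSES k l) : IsSES (i.prodMap k) (j.prodMap l) :=
  ⟨h.injective.prodMap h'.injective, fun x => by
    rw [Prod.ext_iff]
    exact (and_congr (h.exact x.1) (h'.exact x.2)).trans ⟨fun ⟨⟨a, ha⟩, ⟨b, hb⟩⟩ =>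
      ⟨(a, b), Prod.ext ha hb⟩, fun ⟨y, hy⟩ =>
        ⟨⟨y.1, congrArg Prod.fst hy⟩, ⟨y.2, congrArg Prod.snd hy⟩⟩⟩,
    h.surjective.prodMap h'.surjective⟩

section Composition

variable {X₁' X₁ X₁'' X₂' X₂ X₂'' X₃' X₃ X₃'' E' E E'' F' F F'' : Type*}
  [NormedAddCommGroup X₁'] [NormedSpace ℝ X₁'] [NormedAddCommGroup X₁] [NormedSpace ℝ X₁]
  [NormedAddCommGroup X₁''] [NormedSpace ℝ X₁''] [NormedAddCommGroup X₂'] [NormedSpace ℝ X₂']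
  [NormedAddCommGroup X₂] [NormedSpace ℝ X₂] [NormedAddCommGroup X₂''] [NormedSpace ℝ X₂'']
  [NormedAddCommGroup X₃'] [NormedSpace ℝ X₃'] [NormedAddCommGroup X₃] [NormedSpace ℝ X₃]
  [NormedAddCommGroup X₃''] [NormedSpace ℝ X₃'']
  [AddCommGroup E'] [Module ℝ E'] [AddCommGroup E] [Module ℝ E] [AddCommGroup E''] [Module ℝ E'']
  [AddCommGroup F'] [Module ℝ F'] [AddCommGroup F] [Module ℝ F] [AddCommGroup F''] [Module ℝ F'']
  {r₁ : BanachSES X₁' X₁ X₁''} {r₂ : BanachSES X₂' X₂ X₂''} {r₃ : BanachSES X₃' X₃ X₃''}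

theorem FredholmOp.ind_eq_of_model {X Y K E : Type*} [NormedAddCommGroup X] [NormedSpace ℝ X]
    [NormedAddCommGroup Y] [NormedSpace ℝ Y] [AddCommGroup K] [Module ℝ K] [AddCommGroup E]
    [Module ℝ E] [FiniteDimensional ℝ K] [FiniteDimensional ℝ E] {D : FredholmOp X Y}
    (m : Model D K E) : D.ind = finrank ℝ K - finrank ℝ E := by
  have h1 := finrank_eq_add_of_exact m.sesKer.injective m.sesKer.exact m.sesKer.surjective
  have h2 := finrank_eq_add_of_exact m.sesCoker.injective m.sesCoker.exact m.sesCoker.surjective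
  rw [FredholmOp.ind]
  omega

theorem ExactTriple.ind_mid (t : ExactTriple r₁ r₂) : t.mid.ind = t.left.ind + t.right.ind := by
  have h1 := finrank_eq_add_of_exact t.kerI_injective (exact_rangeRestrict t.exact_kerI_kerJ)
    t.kerJ.surjective_rangeRestrict
  have h2 := finrank_eq_add_of_exact (LinearMap.range t.kerJ).subtype_injective
    (exact_range_subtype (exact_rangeRestrict t.exact_kerJ_delta))
    t.delta.surjective_rangeRestrict
  have h3 := finrank_eq_add_of_exact (LinearMap.range t.delta).subtype_injective
    (exact_range_subtype (exact_rangeRestrict t.exact_delta_cokerI))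
    t.cokerI.surjective_rangeRestrict
  have h4 := finrank_eq_add_of_exact (LinearMap.range t.cokerI).subtype_injective
    (exact_range_subtype t.exact_cokerI_cokerJ) t.cokerJ_surjective
  rw [FredholmOp.ind, FredholmOp.ind, FredholmOp.ind]
  omega

theorem FredholmOp.ind_comp {X Y Z : Type*} [NormedAddCommGroup X] [NormedSpace ℝ X]
    [NormedAddCommGroup Y] [NormedSpace ℝ Y] [NormedAddCommGroup Z] [NormedSpace ℝ Z]
    (D₁ : FredholmOp X Y) (D₂ : FredholmOp Y Z) : (D₂.comp D₁).ind = D₁.ind + D₂.ind := by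
  rw [← (compTriple D₁ D₂).ind_mid, FredholmOp.ind, FredholmOp.ind,
    (stabKer (D₂.comp D₁) Y).finrank_eq, (stabCoker (D₂.comp D₁) Y).finrank_eq]

/-- The linear map `(e', e'') ↦ 𝔦 (T' e') + σ (T'' e'')`, where `σ` is a section of `𝔧`, lies
over `T''`. -/
theorem j_coprod_sectionOf {X X' X'' E E'' : Type*} [NormedAddCommGroup X'] [NormedSpace ℝ X']
    [NormedAddCommGroup X] [NormedSpace ℝ X] [NormedAddCommGroup X''] [NormedSpace ℝ X'']
    [AddCommGroup E] [Module ℝ E] [AddCommGroup E''] [Module ℝ E''] {r : BanachSES X' X X''}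
    (T' : E →ₗ[ℝ] X') (T'' : E'' →ₗ[ℝ] X'') (e : E × E'') :
    r.j (((r.i.toLinearMap ∘ₗ T').coprod (sectionOf r.surjective ∘ₗ T'')) e) =
      T'' (LinearMap.snd ℝ E E'' e) := by
  change r.j (r.i (T' e.1) + sectionOf r.surjective (T'' e.2)) = T'' e.2
  rw [map_add, r.exact.apply_apply_eq_zero, zero_add]
  exact sectionOf_apply r.surjective _

/-! ### The diagram of models of two composable triples -/

section Maps

variable {t₁ : ExactTriple r₁ r₂} {t₂ : ExactTriple r₂ r₃}
  {iE : E' →ₗ[ℝ] E} {jE : E →ₗ[ℝ] E''} {T' : E' →ₗ[ℝ] X₂'} {T : E →ₗ[ℝ] X₂}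
  {T'' : E'' →ₗ[ℝ] X₂''} {iF : F' →ₗ[ℝ] F} {jF : F →ₗ[ℝ] F''} {U' : F' →ₗ[ℝ] X₃'}
  {U : F →ₗ[ℝ] X₃} {U'' : F'' →ₗ[ℝ] X₃''}

theorem coprod_comm_i (hiE : ∀ e, r₂.i (T' e) = T (iE e)) (hiF : ∀ e, r₃.i (U' e) = U (iF e))
    (e : E' × F') : r₃.i (((t₂.left.lin ∘ₗ T').coprod U') e) =
      ((t₂.mid.lin ∘ₗ T).coprod U) (iE.prodMap iF e) := by
  change r₃.i (t₂.left.toCLM (T' e.1) + U' e.2) = t₂.mid.toCLM (T (iE e.1)) + U (iF e.2)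
  rw [map_add, hiF, ← t₂.comm_i, hiE]

theorem coprod_comm_j (hjE : ∀ e, r₂.j (T e) = T'' (jE e)) (hjF : ∀ e, r₃.j (U e) = U'' (jF e))
    (e : E × F) : r₃.j (((t₂.mid.lin ∘ₗ T).coprod U) e) =
      ((t₂.right.lin ∘ₗ T'').coprod U'') (jE.prodMap jF e) := by
  change r₃.j (t₂.mid.toCLM (T e.1) + U e.2) = t₂.right.toCLM (T'' (jE e.1)) + U'' (jF e.2)
  rw [map_add, hjF, ← t₂.comm_j, hjE]

theorem compI_tripleI (hiE : ∀ e, r₂.i (T' e) = T (iE e)) (hiF : ∀ e, r₃.i (U' e) = U (iF e))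
    (k : pullback t₁.left.lin T') :
    compI t₁.mid t₂.mid T U (tripleI t₁ hiE k) =
      tripleI (t₁.comp t₂) (coprod_comm_i hiE hiF) (compI t₁.left t₂.left T' U' k) :=
  Subtype.ext (Prod.ext rfl (Prod.ext rfl (map_zero iF).symm))

theorem compI_tripleJ (hjE : ∀ e, r₂.j (T e) = T'' (jE e)) (hjF : ∀ e, r₃.j (U e) = U'' (jF e))
    (k : pullback t₁.mid.lin T) :
    compI t₁.right t₂.right T'' U'' (tripleJ t₁ hjE k) =
      tripleJ (t₁.comp t₂) (coprod_comm_j hjE hjF) (compI t₁.mid t₂.mid T U k) :=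
  Subtype.ext (Prod.ext rfl (Prod.ext rfl (map_zero jF).symm))

theorem compJ_tripleI (hiE : ∀ e, r₂.i (T' e) = T (iE e)) (hiF : ∀ e, r₃.i (U' e) = U (iF e))
    (k : pullback (t₁.comp t₂).left.lin ((t₂.left.lin ∘ₗ T').coprod U')) :
    compJ t₁.mid t₂.mid T U (tripleI (t₁.comp t₂) (coprod_comm_i hiE hiF) k) =
      tripleI t₂ hiF (compJ t₁.left t₂.left T' U' k) := by
  refine Subtype.ext (Prod.ext ?_ rfl)
  change t₁.mid.toCLM (r₁.i k.1.1) - T (iE k.1.2.1) =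
    r₂.i (t₁.left.toCLM k.1.1 - T' k.1.2.1)
  rw [map_sub, t₁.comm_i, hiE]

theorem compJ_tripleJ (hjE : ∀ e, r₂.j (T e) = T'' (jE e)) (hjF : ∀ e, r₃.j (U e) = U'' (jF e))
    (k : pullback (t₁.comp t₂).mid.lin ((t₂.mid.lin ∘ₗ T).coprod U)) :
    compJ t₁.right t₂.right T'' U'' (tripleJ (t₁.comp t₂) (coprod_comm_j hjE hjF) k) =
      tripleJ t₂ hjF (compJ t₁.mid t₂.mid T U k) := by
  refine Subtype.ext (Prod.ext ?_ rfl)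
  change t₁.right.toCLM (r₁.j k.1.1) - T'' (jE k.1.2.1) =
    r₂.j (t₁.mid.toCLM k.1.1 - T k.1.2.1)
  rw [map_sub, t₁.comm_j, hjE]

end Maps

/-! ### Compatibility of `Ψ` with compositions -/

/-- The compatibility of `Ψ` with compositions on the elements that are given by models. -/
theorem comp_psi_det [FiniteDimensional ℝ E'] [FiniteDimensional ℝ E] [FiniteDimensional ℝ E'']
    [FiniteDimensional ℝ F'] [FiniteDimensional ℝ F] [FiniteDimensional ℝ F'']
    (t₁ : ExactTriple r₁ r₂) (t₂ : ExactTriple r₂ r₃)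
    {iE : E' →ₗ[ℝ] E} {jE : E →ₗ[ℝ] E''} {T' : E' →ₗ[ℝ] X₂'} {T : E →ₗ[ℝ] X₂}
    {T'' : E'' →ₗ[ℝ] X₂''} {iF : F' →ₗ[ℝ] F} {jF : F →ₗ[ℝ] F''} {U' : F' →ₗ[ℝ] X₃'}
    {U : F →ₗ[ℝ] X₃} {U'' : F'' →ₗ[ℝ] X₃''} (hE : IsSES iE jE) (hF : IsSES iF jF)
    (hiE : ∀ e, r₂.i (T' e) = T (iE e)) (hjE : ∀ e, r₂.j (T e) = T'' (jE e))
    (hiF : ∀ e, r₃.i (U' e) = U (iF e)) (hjF : ∀ e, r₃.j (U e) = U'' (jF e))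
    (hT' : Transverse t₁.left.lin T') (hT'' : Transverse t₁.right.lin T'')
    (hU' : Transverse t₂.left.lin U') (hU'' : Transverse t₂.right.lin U'')
    (k₁' : TopExt (pullback t₁.left.lin T')) (e₁' : TopExt E')
    (k₁'' : TopExt (pullback t₁.right.lin T'')) (e₁'' : TopExt E'')
    (k₂' : TopExt (pullback t₂.left.lin U')) (e₂' : TopExt F')
    (k₂'' : TopExt (pullback t₂.right.lin U'')) (e₂'' : TopExt F'') :
    compIso t₁.mid t₂.mid
        (t₁.psi ((pullbackModel t₁.left T' hT').det k₁' e₁' ⊗ₜ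
          (pullbackModel t₁.right T'' hT'').det k₁'' e₁'') ⊗ₜ
        t₂.psi ((pullbackModel t₂.left U' hU').det k₂' e₂' ⊗ₜ
          (pullbackModel t₂.right U'' hU'').det k₂'' e₂'')) =
      sgn (t₁.right.ind * t₂.left.ind) • (t₁.comp t₂).psi
        (compIso t₁.left t₂.left ((pullbackModel t₁.left T' hT').det k₁' e₁' ⊗ₜ
          (pullbackModel t₂.left U' hU').det k₂' e₂') ⊗ₜ
        compIso t₁.right t₂.right ((pullbackModel t₁.right T'' hT'').det k₁'' e₁'' ⊗ₜ
          (pullbackModel t₂.right U'' hU'').det k₂'' e₂'')) := by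
  have hT := transverse_mid t₁ hE hiE hjE hT' hT''
  have hU := transverse_mid t₂ hF hiF hjF hU' hU''
  have M₁ := modelTriple_pullback t₁ hE hiE hjE hT' hT hT''
  have M₂ := modelTriple_pullback t₂ hF hiF hjF hU' hU hU''
  have M' := modelTriple_comp hT' hU'
  have M := modelTriple_comp hT hU
  have M'' := modelTriple_comp hT'' hU''
  have M₃ := modelTriple_pullback (t₁.comp t₂) (hE.prodMap hF) (coprod_comm_i hiE hiF)
    (coprod_comm_j hjE hjF)
    (hT'.comp_coprod hU') (hT.comp_coprod hU) (hT''.comp_coprod hU'')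
  have hK := wedge_wedge_comm M₁.sesK M₃.sesK M₂.sesK M'.sesK M.sesK M''.sesK
    (compI_tripleI hiE hiF) (compI_tripleJ hjE hjF) (compJ_tripleI hiE hiF)
    (compJ_tripleJ hjE hjF)
    k₁' k₁'' k₂' k₂''
  have hE' := wedge_wedge_comm hE (hE.prodMap hF) hF (isSES_inl_snd E' F') (isSES_inl_snd E F)
    (isSES_inl_snd E'' F'') (fun x => Prod.ext rfl (map_zero iF).symm)
    (fun x => Prod.ext rfl (map_zero jF).symm) (fun x => rfl) (fun x => rfl)
    e₁' e₁'' e₂' e₂''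
  rw [M₁.psi_det, M₂.psi_det, compIso_det hT' hU', compIso_det hT'' hU'']
  simp only [Units.smul_def (sgn _), TensorProduct.tmul_smul, ← TensorProduct.smul_tmul',
    map_smul]
  simp only [← Units.smul_def (sgn _)]
  rw [compIso_det hT hU, M₃.psi_det, hK, hE', Model.det_sgn_smul]
  simp only [sgn_smul_smul]
  congr 1
  have n1 := FredholmOp.ind_eq_of_model (pullbackModel t₁.right T'' hT'')
  have n2 := FredholmOp.ind_eq_of_model (pullbackModel t₂.left U' hU')
  have n3 := finrank_eq_add_of_exact hE.injective hE.exact hE.surjective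
  rw [sub_eq_iff_eq_add.1 n1.symm, sub_eq_iff_eq_add.1 n2.symm, FredholmOp.ind_comp,
    t₂.ind_mid, ← n3, finrank_prod]
  push_cast
  exact sgn_eq_of_even_sub ⟨finrank ℝ E'' * (t₂.left.ind + finrank ℝ F'), by ring⟩

end Composition

/-- Linear maps on a line agree if they agree on one nonzero vector. -/
theorem linearEquiv_ext_of_finrank_eq_one {L M : Type*} [AddCommGroup L] [Module ℝ L]
    [AddCommGroup M] [Module ℝ M] (hL : finrank ℝ L = 1) {f g : L ≃ₗ[ℝ] M} {v : L} (hv : v ≠ 0)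
    (h : f v = g v) : f = g := by
  ext w
  obtain ⟨c, rfl⟩ := exists_smul_eq_of_finrank_eq_one hL hv w
  rw [map_smul, map_smul, h]

theorem middleMap_gradedSwap_tmul {A E X₁ Y₁ X₂ Y₂ : Type*} [AddCommGroup A] [Module ℝ A]
    [AddCommGroup E] [Module ℝ E] [NormedAddCommGroup X₁] [NormedSpace ℝ X₁]
    [NormedAddCommGroup Y₁] [NormedSpace ℝ Y₁] [NormedAddCommGroup X₂] [NormedSpace ℝ X₂]
    [NormedAddCommGroup Y₂] [NormedSpace ℝ Y₂] (D₁ : FredholmOp X₁ Y₁) (D₂ : FredholmOp X₂ Y₂)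
    (a : A) (b : DetLine D₁) (c : DetLine D₂) (e : E) :
    middleMap (gradedSwap D₁ D₂) ((a ⊗ₜ b) ⊗ₜ (c ⊗ₜ e)) =
      sgn (D₁.ind * D₂.ind) • ((a ⊗ₜ[ℝ] c) ⊗ₜ[ℝ] (b ⊗ₜ[ℝ] e)) := by
  have h : gradedSwap D₁ D₂ (b ⊗ₜ c) = sgn (D₁.ind * D₂.ind) • (c ⊗ₜ[ℝ] b) := rfl
  simp only [middleMap, LinearEquiv.trans_apply, TensorProduct.assoc_tmul,
    TensorProduct.congr_tmul, TensorProduct.assoc_symm_tmul, h, LinearEquiv.refl_apply]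
  simp only [Units.smul_def (sgn _), TensorProduct.tmul_smul, ← TensorProduct.smul_tmul',
    map_smul, TensorProduct.assoc_tmul, TensorProduct.assoc_symm_tmul]

end

end FredholmDet

theorem mainTheorem4
    {X₁' X₁ X₁'' X₂' X₂ X₂'' X₃' X₃ X₃'' : Type*}
    [NormedAddCommGroup X₁'] [NormedSpace ℝ X₁'] [CompleteSpace X₁']
    [NormedAddCommGroup X₁] [NormedSpace ℝ X₁] [CompleteSpace X₁]
    [NormedAddCommGroup X₁''] [NormedSpace ℝ X₁''] [CompleteSpace X₁'']
    [NormedAddCommGroup X₂'] [NormedSpace ℝ X₂'] [CompleteSpace X₂']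
    [NormedAddCommGroup X₂] [NormedSpace ℝ X₂] [CompleteSpace X₂]
    [NormedAddCommGroup X₂''] [NormedSpace ℝ X₂''] [CompleteSpace X₂'']
    [NormedAddCommGroup X₃'] [NormedSpace ℝ X₃'] [CompleteSpace X₃']
    [NormedAddCommGroup X₃] [NormedSpace ℝ X₃] [CompleteSpace X₃]
    [NormedAddCommGroup X₃''] [NormedSpace ℝ X₃''] [CompleteSpace X₃'']
    {r₁ : FredholmDet.BanachSES X₁' X₁ X₁''} {r₂ : FredholmDet.BanachSES X₂' X₂ X₂''}
    {r₃ : FredholmDet.BanachSES X₃' X₃ X₃''}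
    (t₁ : FredholmDet.ExactTriple r₁ r₂) (t₂ : FredholmDet.ExactTriple r₂ r₃) :
    TensorProduct.congr t₁.psi t₂.psi ≪≫ₗ FredholmDet.compIso t₁.mid t₂.mid =
      FredholmDet.middleMap (FredholmDet.gradedSwap t₁.right t₂.left) ≪≫ₗ
        TensorProduct.congr (FredholmDet.compIso t₁.left t₂.left)
          (FredholmDet.compIso t₁.right t₂.right) ≪≫ₗ
        (t₁.comp t₂).psi := by
  open FredholmDet in
  obtain ⟨T', hT'⟩ := exists_transverse t₁.left
  obtain ⟨T'', hT''⟩ := exists_transverse t₁.right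
  obtain ⟨U', hU'⟩ := exists_transverse t₂.left
  obtain ⟨U'', hU''⟩ := exists_transverse t₂.right
  obtain ⟨k₁', hk₁'⟩ := exists_topExt_ne_zero (pullback t₁.left.lin T')
  obtain ⟨k₁'', hk₁''⟩ := exists_topExt_ne_zero (pullback t₁.right.lin T'')
  obtain ⟨k₂', hk₂'⟩ := exists_topExt_ne_zero (pullback t₂.left.lin U')
  obtain ⟨k₂'', hk₂''⟩ := exists_topExt_ne_zero (pullback t₂.right.lin U'')
  obtain ⟨e₁', he₁'⟩ := exists_topExt_ne_zero t₁.left.coker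
  obtain ⟨e₁'', he₁''⟩ := exists_topExt_ne_zero t₁.right.coker
  obtain ⟨e₂', he₂'⟩ := exists_topExt_ne_zero t₂.left.coker
  obtain ⟨e₂'', he₂''⟩ := exists_topExt_ne_zero t₂.right.coker
  -- both sides are linear maps on a line, so it suffices to compare them on one nonzero vector
  refine linearEquiv_ext_of_finrank_eq_one (by simp only [finrank_tensorProduct, finrank_detLine])
    (tmul_ne_zero
      (tmul_ne_zero ((pullbackModel t₁.left T' hT').det_ne_zero hk₁' he₁')
        ((pullbackModel t₁.right T'' hT'').det_ne_zero hk₁'' he₁''))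
      (tmul_ne_zero ((pullbackModel t₂.left U' hU').det_ne_zero hk₂' he₂')
        ((pullbackModel t₂.right U'' hU'').det_ne_zero hk₂'' he₂''))) ?_
  simp only [LinearEquiv.trans_apply, TensorProduct.congr_tmul]
  rw [middleMap_gradedSwap_tmul, map_sgn_smul, map_sgn_smul, TensorProduct.congr_tmul]
  exact comp_psi_det t₁ t₂ (isSES_inl_snd _ _) (isSES_inl_snd _ _)
    (T := (r₂.i.toLinearMap ∘ₗ T').coprod (sectionOf r₂.surjective ∘ₗ T''))
    (U := (r₃.i.toLinearMap ∘ₗ U').coprod (sectionOf r₃.surjective ∘ₗ U''))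
    (fun e => by simp) (j_coprod_sectionOf T' T'') (fun e => by simp) (j_coprod_sectionOf U' U'')
    hT' hT'' hU' hU'' _ _ _ _ _ _ _ _
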